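/- Let $L_O$ be the two-sorted language with sorts $K$ and $V$ consisting of: the language of rings on $K$; the language of abelian groups on $V$; a function symbol $\cdot : K\times V\to V$; for each $n\ge 1$ an $n$-ary predicate $\theta_n$ on $V$ and function symbols $\pi_{n,i}:V^{n+1}\to K$ ($1\le i\le n$); and a function symbol $q:V\to K$. Let $T^0_O$ be the $L_O$-theory asserting that $K$ is a field of characteristic $2$; that $V$ is a $K$-vector space; that $\theta_n(v_1,\dots,v_n)$ holds if and only if $v_1,\dots,v_n$ are linearly independent; that $\pi_{n,i}(v_1,\dots,v_n,w)=\alpha_i$ if $v_1,\dots,v_n$ are linearly independent and $w=\sum_{j}\alpha_jv_j$, and $\pi_{n,i}(v_1,\dots,v_n,w)=0$ if $v_1,\dots,v_n$ are linearly dependent or $w$ is not in their span; and that $q$ is a quadratic form on $V$, i.e. $q(\alpha v)=\alpha^2q(v)$ and $\beta(x,y)=q(x+y)-q(x)-q(y)$ is a non-degenerate symmetric $K$-bilinear map. A model $M$ of $T^0_O$ is called pseudo-finite if it is infinite and every $L_O$-sentence true in $M$ is true in some finite model of $T^0_O$; a theory is called pseudo-finite if all its models are pseudo-finite. Let $T$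 be a completion of $T^0_O$ (a consistent $L_O$-theory which implies $T^0_O$ and decides every $L_O$-sentence) which asserts that $V$ is infinite dimensional and which either is pseudo-finite or asserts that $K$ is algebraically closed. Then $T$ eliminates quantifiers down to those on the field: every $L_O$-formula is equivalent modulo $T$, in the same free variables, to a Boolean combination of quantifier-free $L_O$-formulas and of formulas $\psi(t_1,\dots,t_k)$, where $\psi(x_1,\dots,x_k)$ is a first-order formula of the language of rings, with all variables and quantifiers ranging over $K$, and $t_1,\dots,t_k$ are $K$-valued $L_O$-terms. If moreover $T$ asserts that $K$ is algebraically closed, then $T$ eliminates quantifiers outright: every $L_O$-formula is equivalent modulo $T$ to a quantifier-free $L_O$-formula in the same free variables. -/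

import Mathlib

/-! Two-sorted first-order logic for the language of orthogonal spaces, the theory of orthogonal
spaces in characteristic two, its completions, and elimination of quantifiers. -/

universe u

namespace Orth

/-- The two sorts: the field sort `K` and the vector space sort `V`. -/
inductive Srt : Type
  | K
  | V

/-! ### Syntax -/

/-- Terms of the language, in the field variables `x_i` (`i < m`) and the vector variables `v_j`
(`j < n`). On `K` there is the language of rings, on `V` the language of abelian groups; there are
scalar multiplication, the coordinate functions `π_{r+1,i+1} : V^{r+2} → K` (here `coord r i`), and
`q : V → K`. -/
inductive Term (m n : ℕ) : Srt → Type
  | kvar : Fin m → Term m n Srt.K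
  | vvar : Fin n → Term m n Srt.V
  | kzero : Term m n Srt.K
  | kone : Term m n Srt.K
  | kadd : Term m n Srt.K → Term m n Srt.K → Term m n Srt.K
  | kmul : Term m n Srt.K → Term m n Srt.K → Term m n Srt.K
  | kneg : Term m n Srt.K → Term m n Srt.K
  | vzero : Term m n Srt.V
  | vadd : Term m n Srt.V → Term m n Srt.V → Term m n Srt.V
  | vneg : Term m n Srt.V → Term m n Srt.V
  | smul : Term m n Srt.K → Term m n Srt.V → Term m n Srt.V
  | coord (r : ℕ) (i : Fin (r + 1)) :
      (Fin (r + 1) → Term m n Srt.V) → Term m n Srt.V → Term m n Srt.K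
  | q : Term m n Srt.V → Term m n Srt.K

/-- Formulas with free variables among the field variables `x_i` (`i < m`) and the vector variables
`v_j` (`j < n`). `theta r` is the linear independence predicate on `(r + 1)`-tuples. The quantifier
`allK` binds the field variable of the largest index `m`, and `allV` the vector variable of the
largest index `n`. -/
inductive Formula : ℕ → ℕ → Type
  | bot {m n : ℕ} : Formula m n
  | eqK {m n : ℕ} : Term m n Srt.K → Term m n Srt.K → Formula m n
  | eqV {m n : ℕ} : Term m n Srt.V → Term m n Srt.V → Formula m n
  | theta {m n : ℕ} (r : ℕ) : (Fin (r + 1) → Term m n Srt.V) → Formula m n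
  | imp {m n : ℕ} : Formula m n → Formula m n → Formula m n
  | allK {m n : ℕ} : Formula (m + 1) n → Formula m n
  | allV {m n : ℕ} : Formula m (n + 1) → Formula m n

namespace Term

variable {m n : ℕ}

instance : Zero (Term m n Srt.K) := ⟨kzero⟩
instance : One (Term m n Srt.K) := ⟨kone⟩
instance : Add (Term m n Srt.K) := ⟨kadd⟩
instance : Mul (Term m n Srt.K) := ⟨kmul⟩
instance : Neg (Term m n Srt.K) := ⟨kneg⟩
instance : Zero (Term m n Srt.V) := ⟨vzero⟩
instance : Add (Term m n Srt.V) := ⟨vadd⟩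
instance : Neg (Term m n Srt.V) := ⟨vneg⟩
instance : SMul (Term m n Srt.K) (Term m n Srt.V) := ⟨smul⟩

/-- The term `β(v, w) = q(v + w) - q(v) - q(w)`. -/
def beta (v w : Term m n Srt.V) : Term m n Srt.K := q (v + w) + -q v + -q w

/-- The term `t ^ k`. -/
def kpow (t : Term m n Srt.K) : ℕ → Term m n Srt.K
  | 0 => 1
  | k + 1 => kpow t k * t

/-- The finite sum of a family of field terms. -/
def ksum {r : ℕ} (t : Fin r → Term m n Srt.K) : Term m n Srt.K :=
  (List.ofFn t).foldr (· + ·) 0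

/-- The finite sum of a family of vector terms. -/
def vsum {r : ℕ} (t : Fin r → Term m n Srt.V) : Term m n Srt.V :=
  (List.ofFn t).foldr (· + ·) 0

/-- Simultaneous substitution of terms for the variables of a term. -/
def subst {m' n' : ℕ} (f : Fin m → Term m' n' Srt.K) (g : Fin n → Term m' n' Srt.V) :
    {s : Srt} → Term m n s → Term m' n' s
  | _, kvar i => f i
  | _, vvar j => g j
  | _, kzero => kzero
  | _, kone => kone
  | _, kadd t u => kadd (t.subst f g) (u.subst f g)
  | _, kmul t u => kmul (t.subst f g) (u.subst f g)
  | _, kneg t => kneg (t.subst f g)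
  | _, vzero => vzero
  | _, vadd t u => vadd (t.subst f g) (u.subst f g)
  | _, vneg t => vneg (t.subst f g)
  | _, smul t u => smul (t.subst f g) (u.subst f g)
  | _, coord r i v w => coord r i (fun j => (v j).subst f g) (w.subst f g)
  | _, q v => q (v.subst f g)

/-- Weakening by one new field variable. -/
def liftK {s : Srt} (t : Term m n s) : Term (m + 1) n s :=
  t.subst (fun i => kvar i.castSucc) vvar

/-- Weakening by one new vector variable. -/
def liftV {s : Srt} (t : Term m n s) : Term m (n + 1) s :=
  t.subst kvar (fun j => vvar j.castSucc)

/-- The terms of the language of rings (on the field sort). -/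
def IsRing : {s : Srt} → Term m n s → Prop
  | _, kvar _ => True
  | _, kzero => True
  | _, kone => True
  | _, kadd t u => t.IsRing ∧ u.IsRing
  | _, kmul t u => t.IsRing ∧ u.IsRing
  | _, kneg t => t.IsRing
  | _, _ => False

end Term

namespace Formula

/-- Negation. -/
def not {m n : ℕ} (φ : Formula m n) : Formula m n := φ.imp bot

/-- Conjunction. -/
def and {m n : ℕ} (φ ψ : Formula m n) : Formula m n := (φ.imp ψ.not).not

/-- Biconditional. -/
def iff {m n : ℕ} (φ ψ : Formula m n) : Formula m n := (φ.imp ψ).and (ψ.imp φ)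

/-- Existential quantification over the field sort. -/
def exK {m n : ℕ} (φ : Formula (m + 1) n) : Formula m n := φ.not.allK.not

/-- Conjunction of a finite family. -/
def conj {m n r : ℕ} (φ : Fin r → Formula m n) : Formula m n :=
  (List.ofFn φ).foldr and bot.not

/-- Universal quantification over all the free field variables. -/
def closeK : {m n : ℕ} → Formula m n → Formula 0 n
  | 0, _, φ => φ
  | _ + 1, _, φ => closeK φ.allK

/-- Universal quantification over all the free vector variables. -/
def closeV : {m n : ℕ} → Formula m n → Formula m 0
  | _, 0, φ => φ
  | _, _ + 1, φ => closeV φ.allV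

/-- Universal closure. -/
def close {m n : ℕ} (φ : Formula m n) : Formula 0 0 := φ.closeK.closeV

/-- Simultaneous (capture-free) substitution of terms for the free variables of a formula. -/
def subst : {m n : ℕ} → Formula m n → {m' n' : ℕ} →
    (Fin m → Term m' n' Srt.K) → (Fin n → Term m' n' Srt.V) → Formula m' n'
  | _, _, bot, _, _, _, _ => bot
  | _, _, eqK t u, _, _, f, g => eqK (t.subst f g) (u.subst f g)
  | _, _, eqV t u, _, _, f, g => eqV (t.subst f g) (u.subst f g)
  | _, _, theta r v, _, _, f, g => theta r (fun j => (v j).subst f g)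
  | _, _, imp φ ψ, _, _, f, g => imp (φ.subst f g) (ψ.subst f g)
  | _, _, allK φ, m', n', f, g =>
      allK (φ.subst
        (Fin.snoc (α := fun _ => Term (m' + 1) n' Srt.K) (fun i => (f i).liftK)
          (Term.kvar (Fin.last m')))
        (fun j => (g j).liftK))
  | _, _, allV φ, m', n', f, g =>
      allV (φ.subst (fun i => (f i).liftV)
        (Fin.snoc (α := fun _ => Term m' (n' + 1) Srt.V) (fun j => (g j).liftV)
          (Term.vvar (Fin.last n'))))

/-- Quantifier-free formulas. -/
def IsQF : {m n : ℕ} → Formula m n → Prop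
  | _, _, bot => True
  | _, _, eqK _ _ => True
  | _, _, eqV _ _ => True
  | _, _, theta _ _ => True
  | _, _, imp φ ψ => φ.IsQF ∧ ψ.IsQF
  | _, _, allK _ => False
  | _, _, allV _ => False

/-- The first-order formulas of the language of rings, on the field sort. -/
def IsRing : {m n : ℕ} → Formula m n → Prop
  | _, _, bot => True
  | _, _, eqK t u => t.IsRing ∧ u.IsRing
  | _, _, eqV _ _ => False
  | _, _, theta _ _ => False
  | _, _, imp φ ψ => φ.IsRing ∧ ψ.IsRing
  | _, _, allK φ => φ.IsRing
  | _, _, allV _ => False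

/-- Formulas whose only quantifiers are those of field formulas: Boolean combinations of
quantifier-free formulas and of formulas `ψ(t_1, …, t_k)`, where `ψ(x_1, …, x_k)` is a first-order
formula of the language of rings and the `t_i` are terms of the field sort. -/
inductive IsQFDownToField {m n : ℕ} : Formula m n → Prop
  | of_isQF {φ : Formula m n} : φ.IsQF → IsQFDownToField φ
  | of_ring {k : ℕ} (ψ : Formula k 0) (t : Fin k → Term m n Srt.K) : ψ.IsRing →
      IsQFDownToField (ψ.subst t Fin.elim0)
  | imp {φ ψ : Formula m n} : IsQFDownToField φ → IsQFDownToField ψ →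
      IsQFDownToField (φ.imp ψ)

end Formula

/-- Sentences. -/
abbrev Sentence : Type := Formula 0 0

/-- Theories are sets of sentences. -/
abbrev Theory : Type := Set Sentence

/-! ### Semantics -/

/-- Two-sorted structures for the language. -/
structure Struc : Type (u + 1) where
  K : Type u
  V : Type u
  kzero : K
  kone : K
  kadd : K → K → K
  kmul : K → K → K
  kneg : K → K
  vzero : V
  vadd : V → V → V
  vneg : V → V
  smul : K → V → V
  theta (r : ℕ) : (Fin (r + 1) → V) → Prop
  coord (r : ℕ) (i : Fin (r + 1)) : (Fin (r + 1) → V) → V → K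
  q : V → K

/-- The universe of the given sort. -/
def Struc.Carrier (M : Struc.{u}) : Srt → Type u
  | Srt.K => M.K
  | Srt.V => M.V

/-- The value of a term. -/
def Term.val (M : Struc.{u}) {m n : ℕ} (a : Fin m → M.K) (b : Fin n → M.V) :
    {s : Srt} → Term m n s → M.Carrier s
  | _, kvar i => a i
  | _, vvar j => b j
  | _, kzero => M.kzero
  | _, kone => M.kone
  | _, kadd t u => M.kadd (t.val M a b) (u.val M a b)
  | _, kmul t u => M.kmul (t.val M a b) (u.val M a b)
  | _, kneg t => M.kneg (t.val M a b)
  | _, vzero => M.vzero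
  | _, vadd t u => M.vadd (t.val M a b) (u.val M a b)
  | _, vneg t => M.vneg (t.val M a b)
  | _, smul t u => M.smul (t.val M a b) (u.val M a b)
  | _, coord r i v w => M.coord r i (fun j => (v j).val M a b) (w.val M a b)
  | _, q v => M.q (v.val M a b)

/-- Satisfaction of a formula at an assignment `a`, `b` of its free variables. -/
def Formula.Realize (M : Struc.{u}) :
    {m n : ℕ} → Formula m n → (Fin m → M.K) → (Fin n → M.V) → Prop
  | _, _, bot, _, _ => False
  | _, _, eqK t u, a, b => t.val M a b = u.val M a b
  | _, _, eqV t u, a, b => t.val M a b = u.val M a b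
  | _, _, theta r v, a, b => M.theta r (fun j => (v j).val M a b)
  | _, _, imp φ ψ, a, b => φ.Realize M a b → ψ.Realize M a b
  | _, _, allK φ, a, b => ∀ x : M.K, φ.Realize M (Fin.snoc (α := fun _ => M.K) a x) b
  | _, _, allV φ, a, b => ∀ v : M.V, φ.Realize M a (Fin.snoc (α := fun _ => M.V) b v)

/-- The sentence `φ` holds in `M`. -/
def Struc.Sat (M : Struc.{u}) (φ : Sentence) : Prop := φ.Realize M Fin.elim0 Fin.elim0

/-- `M` is a model of `T`. -/
def Struc.Models (M : Struc.{u}) (T : Theory) : Prop := ∀ φ ∈ T, M.Sat φ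

/-- `T ⊨ φ`: in every model of `T`, the formula `φ` holds at all assignments. -/
def Theory.Entails (T : Theory) {m n : ℕ} (φ : Formula m n) : Prop :=
  ∀ M : Struc.{u}, M.Models T → ∀ (a : Fin m → M.K) (b : Fin n → M.V), φ.Realize M a b

/-- `T` is a completion of `T₀`: it is consistent, implies `T₀`, and decides every sentence. -/
structure Theory.IsCompletionOf (T T₀ : Theory) : Prop where
  satisfiable : ∃ M : Struc.{u}, M.Models T
  entails : ∀ φ ∈ T₀, Theory.Entails.{u} T φ
  complete : ∀ φ : Sentence, Theory.Entails.{u} T φ ∨ Theory.Entails.{u} T φ.not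

/-! ### The theory of orthogonal spaces -/

open Term Formula

/-- `K` is a field. -/
def fieldAxioms : Theory :=
  let x : Term 3 0 Srt.K := kvar 0
  let y : Term 3 0 Srt.K := kvar 1
  let z : Term 3 0 Srt.K := kvar 2
  { close (eqK (x + y + z) (x + (y + z))),
    close (eqK (x + y) (y + x)),
    close (eqK (x + 0) x),
    close (eqK (x + -x) 0),
    close (eqK (x * y * z) (x * (y * z))),
    close (eqK (x * y) (y * x)),
    close (eqK (x * 1) x),
    close (eqK (x * (y + z)) (x * y + x * z)),
    (eqK 0 1).not,
    close ((eqK x 0).not.imp (exK (eqK (x.liftK * kvar (Fin.last 3)) 1))) }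

/-- `V` is a vector space over `K`. -/
def vectorSpaceAxioms : Theory :=
  let x : Term 2 3 Srt.K := kvar 0
  let y : Term 2 3 Srt.K := kvar 1
  let u : Term 2 3 Srt.V := vvar 0
  let v : Term 2 3 Srt.V := vvar 1
  let w : Term 2 3 Srt.V := vvar 2
  { close (eqV (u + v + w) (u + (v + w))),
    close (eqV (u + v) (v + u)),
    close (eqV (u + 0) u),
    close (eqV (u + -u) 0),
    close (eqV ((1 : Term 2 3 Srt.K) • u) u),
    close (eqV ((x * y) • u) (x • (y • u))),
    close (eqV ((x + y) • u) (x • u + y • u)),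
    close (eqV (x • (u + v)) (x • u + x • v)) }

/-- `θ(v_0, …, v_r)` holds if and only if `v_0, …, v_r` are linearly independent. -/
def thetaAxiom (r : ℕ) : Sentence :=
  closeV <| iff (theta r vvar) <| closeK <|
    imp (eqV (vsum fun i : Fin (r + 1) => (kvar i : Term (r + 1) (r + 1) Srt.K) • (vvar i : Term (r + 1) (r + 1) Srt.V)) 0)
      (conj fun i : Fin (r + 1) => eqK (kvar i) 0)

/-- If `v_0, …, v_r` are linearly independent and `w = ∑ α_j v_j`, then
`π_i(v_0, …, v_r, w) = α_i`. -/
def coordAxiom (r : ℕ) (i : Fin (r + 1)) : Sentence :=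
  close <| imp
    (and (theta r fun j => vvar j.castSucc)
      (eqV (vvar (Fin.last (r + 1)))
        (vsum fun j : Fin (r + 1) =>
          (kvar j : Term (r + 1) (r + 2) Srt.K) • (vvar j.castSucc : Term (r + 1) (r + 2) Srt.V))))
    (eqK (coord r i (fun j => vvar j.castSucc) (vvar (Fin.last (r + 1)))) (kvar i))

/-- If `v_0, …, v_r` are not linearly independent, or `w` is not of the form `∑ α_j v_j`, then
`π_i(v_0, …, v_r, w) = 0`. -/
def coordZeroAxiom (r : ℕ) (i : Fin (r + 1)) : Sentence :=
  closeV <| imp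
    (not <| and (theta r fun j => vvar j.castSucc)
      (not <| closeK <| not <| eqV (vvar (Fin.last (r + 1)))
        (vsum fun j : Fin (r + 1) =>
          (kvar j : Term (r + 1) (r + 2) Srt.K) • (vvar j.castSucc : Term (r + 1) (r + 2) Srt.V))))
    (eqK (coord r i (fun j => vvar j.castSucc) (vvar (Fin.last (r + 1)))) 0)

/-- The theory `T⁰_{V,K}` of vector spaces with linear independence predicates and coordinate
functions. -/
def TVK : Theory :=
  fieldAxioms ∪ vectorSpaceAxioms ∪ Set.range thetaAxiom ∪
    {φ | ∃ (r : ℕ) (i : Fin (r + 1)), φ = coordAxiom r i ∨ φ = coordZeroAxiom r i}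

/-- `q` is a quadratic form whose associated form `β` is a non-degenerate symmetric bilinear map. -/
def quadraticFormAxioms : Theory :=
  let x : Term 1 3 Srt.K := kvar 0
  let u : Term 1 3 Srt.V := vvar 0
  let v : Term 1 3 Srt.V := vvar 1
  let w : Term 1 3 Srt.V := vvar 2
  { close (eqK (q (x • u)) (x * x * q u)),
    close (eqK (beta u v) (beta v u)),
    close (eqK (beta (u + v) w) (beta u w + beta v w)),
    close (eqK (beta (x • u) v) (x * beta u v)),
    close (imp
      (allV (eqK (beta (vvar 0 : Term 0 2 Srt.V) (vvar 1)) 0))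
      (eqV (vvar 0 : Term 0 1 Srt.V) 0)) }

/-- The theory `T⁰_O` of orthogonal spaces; `K` has characteristic two. -/
def TO : Theory := TVK ∪ quadraticFormAxioms ∪ {eqK (1 + 1) 0}

/-- There are `r + 1` linearly independent vectors. -/
def dimSentence (r : ℕ) : Sentence := not (closeV (not (theta r vvar)))

/-- `T` asserts that `V` is infinite dimensional. -/
def Theory.AssertsInfiniteDim (T : Theory) : Prop :=
  ∀ r : ℕ, Theory.Entails.{u} T (dimSentence r)

/-- Every monic polynomial `X ^ (d + 1) + ∑_{i ≤ d} a_i X ^ i` over `K` has a root in `K`. -/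
def rootSentence (d : ℕ) : Sentence :=
  let x : Term (d + 2) 0 Srt.K := kvar (Fin.last (d + 1))
  closeK <| exK <|
    eqK (x.kpow (d + 1) + ksum fun i : Fin (d + 1) => kvar i.castSucc * x.kpow i) 0

/-- `T` asserts that the field `K` is algebraically closed. -/
def Theory.AssertsAlgClosed (T : Theory) : Prop :=
  ∀ d : ℕ, Theory.Entails.{u} T (rootSentence d)

/-- A pseudo-finite orthogonal space: an infinite model of `T⁰_O` each of whose true sentences
holds in some finite model of `T⁰_O`. -/
structure Struc.IsPseudoFinite (M : Struc.{u}) : Prop where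
  models : M.Models TO
  infinite : Infinite (M.K ⊕ M.V)
  approx : ∀ φ : Sentence, M.Sat φ →
    ∃ N : Struc.{u}, Finite (N.K ⊕ N.V) ∧ N.Models TO ∧ N.Sat φ

/-- `T` is pseudo-finite: its models are pseudo-finite orthogonal spaces. -/
def Theory.IsPseudoFinite (T : Theory) : Prop :=
  ∀ M : Struc.{u}, M.Models T → M.IsPseudoFinite

/-- `T` eliminates quantifiers. -/
def Theory.EliminatesQuantifiers (T : Theory) : Prop :=
  ∀ (m n : ℕ) (φ : Formula m n), ∃ ψ : Formula m n, ψ.IsQF ∧ Theory.Entails.{u} T (φ.iff ψ)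

/-- `T` eliminates quantifiers down to those on the field. -/
def Theory.EliminatesQuantifiersDownToField (T : Theory) : Prop :=
  ∀ (m n : ℕ) (φ : Formula m n), ∃ ψ : Formula m n,
    ψ.IsQFDownToField ∧ Theory.Entails.{u} T (φ.iff ψ)

end Orth

/-!
The point is that, over a fixed finite independent family of vectors, an orthogonal space carries
no more information than its field.

Let `v_1, …, v_r` be independent vectors. A property, expressed by a formula, of scalars and of
linear combinations of the `v_i` is equivalent to a property, expressed by a formula of the
language of rings, of the scalars, of the coefficients, and of the Gram data `q(v_i)`,
`β(v_i, v_j)` (`Formula.reduces`). This is shown by induction on the formula, for all `r` at once.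
The values of terms are definable in the field by linear algebra (`Term.reduces`). A quantifier
over the field is harmless. A quantifier over the vectors `w` splits into two: if `w` is in the
span of the `v_i`, it becomes a quantifier over its coordinates; if it is not, then
`v_1, …, v_r, w` is again independent, and it becomes a quantifier over the Gram data of `w` with
the `v_i`. Here it is essential that these data are arbitrary (`exists_extension`): by
non-degeneracy and infinite dimension there is `w` outside the span with prescribed `β(v_i, w)`, and
there is `z`, orthogonal to the `v_i` and to `w`, with `q(z) ≠ 0`; since every scalar is a square,
`q(w + s z) = q(w) + s² q(z)` takes the prescribed value for a suitable `s`.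

The perfectness of the field is clear if it is algebraically closed, and it passes from finite
fields to pseudo-finite spaces as it is a first-order property
(`Struc.IsPseudoFinite.sat_perfectSentence`).

Given arbitrary vectors, some of them form a basis of their span; which ones do is expressed by a
quantifier-free formula, and the coordinates and Gram data with respect to them are values of
terms. This gives the elimination down to field quantifiers (`Formula.exists_equivalent`). If the
field is algebraically closed, the remaining quantifiers are eliminated by Chevalley's theorem on
constructible sets, applied to affine spaces over `ℤ`
(`FieldFormula.exists_isQF_of_isAlgClosed`).
-/

namespace Orth

open Term Formula

/-! ### Definability in fields -/

/-- First-order formulas of the language of rings with free variables indexed by `ι`. The atomic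
formulas are the equations `p = 0` with `p` an integral polynomial in the variables; `all` binds
the variable `none`. -/
inductive FieldFormula : Type → Type 1
  | zero {ι : Type} (p : MvPolynomial ι ℤ) : FieldFormula ι
  | imp {ι : Type} : FieldFormula ι → FieldFormula ι → FieldFormula ι
  | all {ι : Type} : FieldFormula (Option ι) → FieldFormula ι

namespace FieldFormula

/-- Satisfaction of a formula in a field. -/
def Realize (K : Type u) [Field K] : {ι : Type} → FieldFormula ι → (ι → K) → Prop
  | _, zero p, a => MvPolynomial.aeval a p = 0
  | _, imp φ ψ, a => φ.Realize K a → ψ.Realize K a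
  | _, all φ, a => ∀ x : K, φ.Realize K (fun o => o.elim x a)

/-- Substitution of polynomials for the free variables. -/
noncomputable def subst : {ι κ : Type} → FieldFormula ι → (ι → MvPolynomial κ ℤ) → FieldFormula κ
  | _, _, zero p, f => zero (MvPolynomial.bind₁ f p)
  | _, _, imp φ ψ, f => imp (φ.subst f) (ψ.subst f)
  | _, _, all φ, f => all <| φ.subst fun o =>
      o.elim (MvPolynomial.X none) fun i => MvPolynomial.rename some (f i)

theorem realize_subst {K : Type u} [Field K] {ι κ : Type} (φ : FieldFormula ι)
    (f : ι → MvPolynomial κ ℤ) (a : κ → K) :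
    (φ.subst f).Realize K a ↔ φ.Realize K fun i => MvPolynomial.aeval a (f i) := by
  induction φ generalizing κ with
  | zero p =>
    simp only [subst, Realize, MvPolynomial.aeval_bind₁]
  | imp φ ψ h₁ h₂ => simp only [subst, Realize, h₁, h₂]
  | all φ h =>
    simp only [subst, Realize, h]
    refine forall_congr' fun x => iff_of_eq (congrArg _ (funext fun o => ?_))
    cases o with
    | none => simp
    | some i => simp [MvPolynomial.aeval_rename, Function.comp_def]

end FieldFormula

/-- A family of relations, one on every field, is definable if a single formula of the language of
rings defines it in all fields. -/
def Definable {ι : Type} (P : ∀ (K : Type u) [Field K], (ι → K) → Prop) : Prop :=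
  ∃ φ : FieldFormula ι, ∀ (K : Type u) [Field K] (a : ι → K), φ.Realize K a ↔ P K a

/-- A family of functions, one on every field, is definable if the family of their graphs is. -/
def DefinableFun {ι : Type} (f : ∀ (K : Type u) [Field K], (ι → K) → K) : Prop :=
  Definable fun K _ (a : Option ι → K) => f K (a ∘ some) = a none

namespace Definable

variable {ι κ : Type}

theorem polynomial_eq_zero (p : MvPolynomial ι ℤ) :
    Definable fun (K : Type u) _ (a : ι → K) => MvPolynomial.aeval a p = 0 :=
  ⟨.zero p, fun _ _ _ => Iff.rfl⟩

theorem imp {P Q : ∀ (K : Type u) [Field K], (ι → K) → Prop} (hP : Definable P)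
    (hQ : Definable Q) : Definable fun K _ a => P K a → Q K a := by
  obtain ⟨φ, hφ⟩ := hP
  obtain ⟨ψ, hψ⟩ := hQ
  exact ⟨φ.imp ψ, fun K _ a => imp_congr (hφ K a) (hψ K a)⟩

theorem congr {P Q : ∀ (K : Type u) [Field K], (ι → K) → Prop} (hP : Definable P)
    (h : ∀ (K : Type u) [Field K] (a : ι → K), P K a ↔ Q K a) : Definable Q := by
  obtain ⟨φ, hφ⟩ := hP
  exact ⟨φ, fun K _ a => (hφ K a).trans (h K a)⟩

theorem false : Definable fun (K : Type u) _ (_ : ι → K) => False :=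
  (polynomial_eq_zero 1).congr fun K _ a => by simp

theorem true : Definable fun (K : Type u) _ (_ : ι → K) => True :=
  (false.imp false).congr fun K _ a => by simp

theorem not {P : ∀ (K : Type u) [Field K], (ι → K) → Prop} (hP : Definable P) :
    Definable fun K _ a => ¬ P K a :=
  hP.imp false

theorem and {P Q : ∀ (K : Type u) [Field K], (ι → K) → Prop} (hP : Definable P)
    (hQ : Definable Q) : Definable fun K _ a => P K a ∧ Q K a :=
  (hP.imp hQ.not).not.congr fun K _ a => by tauto

theorem or {P Q : ∀ (K : Type u) [Field K], (ι → K) → Prop} (hP : Definable P)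
    (hQ : Definable Q) : Definable fun K _ a => P K a ∨ Q K a :=
  (hP.not.imp hQ).congr fun K _ a => by tauto

theorem all {P : ∀ (K : Type u) [Field K], (ι → K) → K → Prop}
    (hP : Definable fun K _ (a : Option ι → K) => P K (a ∘ some) (a none)) :
    Definable fun K _ a => ∀ x, P K a x := by
  obtain ⟨φ, hφ⟩ := hP
  exact ⟨φ.all, fun K _ a => forall_congr' fun x => hφ K _⟩

theorem subst {P : ∀ (K : Type u) [Field K], (ι → K) → Prop} (hP : Definable P)
    (f : ι → MvPolynomial κ ℤ) :
    Definable fun K _ (a : κ → K) => P K fun i => MvPolynomial.aeval a (f i) := by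
  obtain ⟨φ, hφ⟩ := hP
  exact ⟨φ.subst f, fun K _ a => (φ.realize_subst f a).trans (hφ K _)⟩

theorem rename {P : ∀ (K : Type u) [Field K], (ι → K) → Prop} (hP : Definable P)
    (e : ι → κ) : Definable fun K _ (a : κ → K) => P K fun i => a (e i) :=
  (hP.subst fun i => MvPolynomial.X (e i)).congr fun K _ a => by simp

theorem forall_index [Finite κ] {P : κ → ∀ (K : Type u) [Field K], (ι → K) → Prop}
    (hP : ∀ k, Definable (P k)) : Definable fun K _ a => ∀ k, P k K a := by
  revert P
  refine Finite.induction_empty_option (P := fun κ =>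
    ∀ {P : κ → ∀ (K : Type u) [Field K], (ι → K) → Prop},
      (∀ k, Definable (P k)) → Definable fun K _ a => ∀ k, P k K a) ?_ ?_ ?_ κ
  · intro α β e ih P hP
    exact (ih fun k => hP (e k)).congr fun K _ a => e.forall_congr_left.trans (by simp)
  · intro P hP
    exact true.congr fun K _ a => by simp
  · intro α _ ih P hP
    exact ((hP none).and (ih fun k => hP (some k))).congr fun K _ a => by
      rw [Option.forall]

theorem forall_tuple [Finite κ] {P : ∀ (K : Type u) [Field K], (ι → K) → (κ → K) → Prop}
    (hP : Definable fun K _ (a : ι ⊕ κ → K) => P K (a ∘ Sum.inl) (a ∘ Sum.inr)) :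
    Definable fun K _ a => ∀ y, P K a y := by
  revert ι P
  refine Finite.induction_empty_option (P := fun κ =>
    ∀ {ι : Type} {P : ∀ (K : Type u) [Field K], (ι → K) → (κ → K) → Prop},
      (Definable fun K _ (a : ι ⊕ κ → K) => P K (a ∘ Sum.inl) (a ∘ Sum.inr)) →
        Definable fun K _ a => ∀ y, P K a y) ?_ ?_ ?_ κ
  · intro α β e ih ι P hP
    refine (ih (P := fun K _ a y => P K a (y ∘ e.symm))
      (hP.rename (Sum.map id e.symm))).congr fun K _ a => ?_
    refine ⟨fun h y => ?_, fun h y => h _⟩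
    simpa [Function.comp_def] using h (y ∘ e)
  · intro ι P hP
    refine (hP.rename (Sum.elim id PEmpty.elim : ι ⊕ PEmpty → ι)).congr fun K _ a => ?_
    exact ⟨fun h y => by
      rwa [Subsingleton.elim y _], fun h => h _⟩
  · intro α _ ih ι P hP
    have h := all (P := fun K _ a x => ∀ y : α → K, P K a fun o => o.elim x y)
      (ih (P := fun K _ a y => P K (a ∘ some) fun o => o.elim (a none) y)
        ((hP.rename (Sum.elim (fun i => Sum.inl (some i))
          fun o => o.elim (Sum.inl none) Sum.inr)).congr fun K _ a => by
            refine iff_of_eq (congrArg₂ _ rfl (funext fun o => ?_))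
            cases o <;> rfl))
    refine h.congr fun K _ a => ⟨fun h y => ?_, fun h x y => h _⟩
    convert h (y none) (y ∘ some) using 2 with o
    cases o <;> rfl

theorem exists_tuple [Finite κ] {P : ∀ (K : Type u) [Field K], (ι → K) → (κ → K) → Prop}
    (hP : Definable fun K _ (a : ι ⊕ κ → K) => P K (a ∘ Sum.inl) (a ∘ Sum.inr)) :
    Definable fun K _ a => ∃ y, P K a y :=
  (forall_tuple (P := fun K _ a y => ¬ P K a y) hP.not).not.congr fun K _ a => by simp

theorem comp [Finite κ] {P : ∀ (K : Type u) [Field K], (κ → K) → Prop} (hP : Definable P)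
    {f : κ → ∀ (K : Type u) [Field K], (ι → K) → K} (hf : ∀ k, DefinableFun (f k)) :
    Definable fun K _ a => P K fun k => f k K a := by
  have h := exists_tuple (ι := ι) (κ := κ) (P := fun K _ a y => (∀ k, f k K a = y k) ∧ P K y)
    (.and (forall_index fun k =>
      Definable.rename (hf k) fun o => o.elim (Sum.inr k) Sum.inl) (hP.rename Sum.inr))
  refine h.congr fun K _ a => ⟨?_, fun h => ⟨_, fun k => rfl, h⟩⟩
  rintro ⟨y, hy, h⟩
  exact (funext hy : (fun k => f k K a) = y) ▸ h

end Definable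

namespace DefinableFun

variable {ι κ : Type}

theorem comp [Finite κ] {g : ∀ (K : Type u) [Field K], (κ → K) → K} (hg : DefinableFun g)
    {f : κ → ∀ (K : Type u) [Field K], (ι → K) → K} (hf : ∀ k, DefinableFun (f k)) :
    DefinableFun fun K _ a => g K fun k => f k K a := by
  have h := Definable.exists_tuple (ι := Option ι) (κ := κ)
    (P := fun K _ a y => (∀ k, f k K (a ∘ some) = y k) ∧ g K y = a none)
    (.and (.forall_index fun k =>
      Definable.rename (hf k) fun o => o.elim (Sum.inr k) fun i => Sum.inl (some i))
      (Definable.rename hg fun o => o.elim (Sum.inl none) Sum.inr))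
  refine h.congr fun K _ a => ⟨?_, fun h => ⟨_, fun k => rfl, h⟩⟩
  rintro ⟨y, hy, h⟩
  exact (congrArg (g K) (funext hy)).trans h

theorem polynomial (p : MvPolynomial ι ℤ) :
    DefinableFun fun (K : Type u) _ (a : ι → K) => MvPolynomial.aeval a p :=
  (Definable.polynomial_eq_zero
    (MvPolynomial.rename some p - MvPolynomial.X none)).congr fun K _ a => by
      simp [MvPolynomial.aeval_rename, sub_eq_zero]

theorem var (i : ι) : DefinableFun fun (K : Type u) _ (a : ι → K) => a i := by
  simpa using polynomial (MvPolynomial.X i)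

theorem rename {f : ∀ (K : Type u) [Field K], (ι → K) → K} (hf : DefinableFun f) (e : ι → κ) :
    DefinableFun fun K _ (a : κ → K) => f K fun i => a (e i) :=
  Definable.rename hf (Option.map e)

theorem zero : DefinableFun fun (K : Type u) _ (_ : ι → K) => 0 := by
  simpa using polynomial (ι := ι) 0

theorem one : DefinableFun fun (K : Type u) _ (_ : ι → K) => 1 := by
  simpa using polynomial (ι := ι) 1

theorem sum [Fintype κ] {f : κ → ∀ (K : Type u) [Field K], (ι → K) → K}
    (hf : ∀ k, DefinableFun (f k)) : DefinableFun fun K _ a => ∑ k, f k K a := by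
  simpa using (polynomial (∑ k : κ, MvPolynomial.X k)).comp hf

theorem add {f g : ∀ (K : Type u) [Field K], (ι → K) → K} (hf : DefinableFun f)
    (hg : DefinableFun g) : DefinableFun fun K _ a => f K a + g K a := by
  have h := (polynomial (MvPolynomial.X true + MvPolynomial.X false)).comp
    (f := fun b K _ a => bif b then f K a else g K a) (Bool.rec hg hf)
  simpa only [map_add, MvPolynomial.aeval_X, cond_true, cond_false] using h

theorem mul {f g : ∀ (K : Type u) [Field K], (ι → K) → K} (hf : DefinableFun f)
    (hg : DefinableFun g) : DefinableFun fun K _ a => f K a * g K a := by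
  have h := (polynomial (MvPolynomial.X true * MvPolynomial.X false)).comp
    (f := fun b K _ a => bif b then f K a else g K a) (Bool.rec hg hf)
  simpa only [map_mul, MvPolynomial.aeval_X, cond_true, cond_false] using h

theorem neg {f : ∀ (K : Type u) [Field K], (ι → K) → K} (hf : DefinableFun f) :
    DefinableFun fun K _ a => - f K a := by
  simpa using (polynomial (-MvPolynomial.X ())).comp (f := fun _ => @f) fun _ => hf

end DefinableFun

theorem Definable.eq {ι : Type} {f g : ∀ (K : Type u) [Field K], (ι → K) → K} (hf : DefinableFun f)
    (hg : DefinableFun g) : Definable fun K _ a => f K a = g K a :=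
  ((Definable.polynomial_eq_zero (MvPolynomial.X ())).comp
    (f := fun _ K _ a => f K a + - g K a) fun _ => hf.add hg.neg).congr fun K _ a => by
      simp [← sub_eq_add_neg, sub_eq_zero]

/-! ### Orthogonal spaces as Mathlib structures -/

/-- The structure `M` is the orthogonal space given by a quadratic form `Q` on a vector space over
a field of characteristic two: the symbols of the language have their standard interpretation in
terms of the algebraic structures on the two sorts, and the polar form of `Q` is non-degenerate. -/
structure IsOrth (M : Struc.{u}) [Field M.K] [AddCommGroup M.V] [Module M.K M.V]
    (Q : QuadraticForm M.K M.V) : Prop where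
  kzero : M.kzero = 0
  kone : M.kone = 1
  kadd : ∀ x y, M.kadd x y = x + y
  kmul : ∀ x y, M.kmul x y = x * y
  kneg : ∀ x, M.kneg x = -x
  vzero : M.vzero = 0
  vadd : ∀ x y, M.vadd x y = x + y
  vneg : ∀ x, M.vneg x = -x
  smul : ∀ x v, M.smul x v = x • v
  q : ∀ v, M.q v = Q v
  theta : ∀ (r : ℕ) (v : Fin (r + 1) → M.V), M.theta r v ↔ LinearIndependent M.K v
  coord : ∀ (r : ℕ) (i : Fin (r + 1)) (v : Fin (r + 1) → M.V) (α : Fin (r + 1) → M.K),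
    LinearIndependent M.K v → M.coord r i v (∑ j, α j • v j) = α i
  coord_eq_zero : ∀ (r : ℕ) (i : Fin (r + 1)) (v : Fin (r + 1) → M.V) (w : M.V),
    ¬ (LinearIndependent M.K v ∧ ∃ α : Fin (r + 1) → M.K, w = ∑ j, α j • v j) →
      M.coord r i v w = 0
  nondegenerate : ∀ v, (∀ w, QuadraticMap.polar Q v w = 0) → v = 0
  two_eq_zero : (1 + 1 : M.K) = 0

section Realize

variable (M : Struc.{u}) {m n : ℕ} (a : Fin m → M.K) (b : Fin n → M.V)

@[simp] theorem realize_not (φ : Formula m n) : φ.not.Realize M a b ↔ ¬ φ.Realize M a b := Iff.rfl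

@[simp] theorem realize_imp (φ ψ : Formula m n) :
    (φ.imp ψ).Realize M a b ↔ (φ.Realize M a b → ψ.Realize M a b) := Iff.rfl

@[simp] theorem realize_and (φ ψ : Formula m n) :
    (φ.and ψ).Realize M a b ↔ φ.Realize M a b ∧ ψ.Realize M a b := by
  simp [Formula.and]

@[simp] theorem realize_iff (φ ψ : Formula m n) :
    (φ.iff ψ).Realize M a b ↔ (φ.Realize M a b ↔ ψ.Realize M a b) := by
  simp [Formula.iff, iff_iff_implies_and_implies]

theorem realize_exK (φ : Formula (m + 1) n) :
    φ.exK.Realize M a b ↔ ∃ x : M.K, φ.Realize M (Fin.snoc (α := fun _ => M.K) a x) b := by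
  simp [Formula.exK, Formula.Realize]

theorem realize_foldr_and (l : List (Formula m n)) :
    (l.foldr Formula.and bot.not).Realize M a b ↔ ∀ φ ∈ l, φ.Realize M a b := by
  induction l with
  | nil => simp [Formula.Realize]
  | cons φ l ih => simp [ih]

theorem realize_conj {r : ℕ} (φ : Fin r → Formula m n) :
    (conj φ).Realize M a b ↔ ∀ i, (φ i).Realize M a b := by
  simp [conj, realize_foldr_and]

end Realize

theorem realize_closeK (M : Struc.{u}) {m n : ℕ} (φ : Formula m n) (a : Fin 0 → M.K)
    (b : Fin n → M.V) : φ.closeK.Realize M a b ↔ ∀ a', φ.Realize M a' b := by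
  induction m with
  | zero => exact ⟨fun h a' => Subsingleton.elim a a' ▸ h, fun h => h a⟩
  | succ m ih =>
    refine (ih φ.allK).trans ⟨fun h a' => ?_, fun h a' x => h _⟩
    rw [← Fin.snoc_init_self a']
    exact h _ _

theorem realize_closeV (M : Struc.{u}) {m n : ℕ} (φ : Formula m n) (a : Fin m → M.K)
    (b : Fin 0 → M.V) : φ.closeV.Realize M a b ↔ ∀ b', φ.Realize M a b' := by
  induction n with
  | zero => exact ⟨fun h b' => Subsingleton.elim b b' ▸ h, fun h => h b⟩
  | succ m ih =>
    refine (ih φ.allV).trans ⟨fun h b' => ?_, fun h b' x => h _⟩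
    rw [← Fin.snoc_init_self b']
    exact h _ _

theorem realize_close (M : Struc.{u}) {m n : ℕ} (φ : Formula m n) :
    M.Sat φ.close ↔ ∀ a b, φ.Realize M a b := by
  refine (realize_closeV M _ _ _).trans ?_
  simp only [realize_closeK]
  exact forall_comm

/-- The value of a field term, as an element of the field. -/
def Term.valK (M : Struc.{u}) {m n : ℕ} (a : Fin m → M.K) (b : Fin n → M.V)
    (t : Term m n Srt.K) : M.K := t.val M a b

/-- The value of a vector term, as a vector. -/
def Term.valV (M : Struc.{u}) {m n : ℕ} (a : Fin m → M.K) (b : Fin n → M.V)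
    (t : Term m n Srt.V) : M.V := t.val M a b

theorem valV_vsum (M : Struc.{u}) [AddCommGroup M.V] (h0 : M.vzero = 0)
    (hadd : ∀ x y, M.vadd x y = x + y) {m n r : ℕ} (t : Fin r → Term m n Srt.V)
    (a : Fin m → M.K) (b : Fin n → M.V) :
    (vsum t).valV M a b = ∑ i, (t i).valV M a b := by
  have h : ∀ l : List (Term m n Srt.V),
      (l.foldr (· + ·) 0).valV M a b = (l.map fun t => t.valV M a b).sum := by
    intro l
    induction l with
    | nil => exact h0
    | cons t l ih =>
      rw [List.map_cons, List.sum_cons, ← ih]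
      exact hadd _ _
  rw [vsum, h, List.map_ofFn, List.sum_ofFn]
  rfl

theorem valV_vsum_smul (M : Struc.{u}) [Field M.K] [AddCommGroup M.V] [Module M.K M.V]
    (h0 : M.vzero = 0) (hadd : ∀ x y, M.vadd x y = x + y) (hsmul : ∀ x v, M.smul x v = x • v)
    {m n r : ℕ} (f : Fin r → Term m n Srt.K) (g : Fin r → Term m n Srt.V) (a : Fin m → M.K)
    (b : Fin n → M.V) :
    (vsum fun i => f i • g i).valV M a b = ∑ i, (f i).valK M a b • (g i).valV M a b :=
  (valV_vsum M h0 hadd _ a b).trans (Finset.sum_congr rfl fun _ _ => hsmul _ _)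

theorem valK_ksum (M : Struc.{u}) [Field M.K] (h0 : M.kzero = 0)
    (hadd : ∀ x y, M.kadd x y = x + y) {m n r : ℕ} (t : Fin r → Term m n Srt.K)
    (a : Fin m → M.K) (b : Fin n → M.V) :
    (ksum t).valK M a b = ∑ i, (t i).valK M a b := by
  have h : ∀ l : List (Term m n Srt.K),
      (l.foldr (· + ·) 0).valK M a b = (l.map fun t => t.valK M a b).sum := by
    intro l
    induction l with
    | nil => exact h0
    | cons t l ih =>
      rw [List.map_cons, List.sum_cons, ← ih]
      exact hadd _ _
  rw [ksum, h, List.map_ofFn, List.sum_ofFn]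
  rfl

theorem exists_field {M : Struc.{u}} (h : M.Models fieldAxioms) :
    ∃ _ : Field M.K, M.kzero = 0 ∧ M.kone = 1 ∧ (∀ x y, M.kadd x y = x + y) ∧
      (∀ x y, M.kmul x y = x * y) ∧ ∀ x, M.kneg x = -x := by
  classical
  let _ : Zero M.K := ⟨M.kzero⟩
  let _ : One M.K := ⟨M.kone⟩
  let _ : Add M.K := ⟨M.kadd⟩
  let _ : Mul M.K := ⟨M.kmul⟩
  let _ : Neg M.K := ⟨M.kneg⟩
  simp only [Struc.Models, fieldAxioms, Set.mem_insert_iff, Set.mem_singleton_iff,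
    forall_eq_or_imp, forall_eq, realize_close] at h
  obtain ⟨h1, h2, h3, h4, h5, h6, h7, h8, h9, h10⟩ := h
  have add_assoc : ∀ x y z : M.K, x + y + z = x + (y + z) := fun x y z => h1 ![x, y, z] ![]
  have add_comm : ∀ x y : M.K, x + y = y + x := fun x y => h2 ![x, y, x] ![]
  have add_zero : ∀ x : M.K, x + 0 = x := fun x => h3 ![x, x, x] ![]
  have add_neg : ∀ x : M.K, x + -x = 0 := fun x => h4 ![x, x, x] ![]
  have mul_assoc : ∀ x y z : M.K, x * y * z = x * (y * z) := fun x y z => h5 ![x, y, z] ![]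
  have mul_comm : ∀ x y : M.K, x * y = y * x := fun x y => h6 ![x, y, x] ![]
  have mul_one : ∀ x : M.K, x * 1 = x := fun x => h7 ![x, x, x] ![]
  have mul_add : ∀ x y z : M.K, x * (y + z) = x * y + x * z := fun x y z => h8 ![x, y, z] ![]
  have zero_ne : (0 : M.K) ≠ 1 := h9
  have exists_inv : ∀ x : M.K, x ≠ 0 → ∃ y, x * y = 1 := fun x hx => by
    obtain ⟨y, hy⟩ := (realize_exK _ _ _ _).1 (h10 ![x, x, x] ![] hx)
    exact ⟨y, hy⟩
  let _ : Inv M.K := ⟨fun x => if hx : x ≠ 0 then (exists_inv x hx).choose else 0⟩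
  let _ : Field M.K := Field.ofMinimalAxioms M.K add_assoc
    (fun x => (add_comm _ _).trans (add_zero x)) (fun x => (add_comm _ _).trans (add_neg x))
    mul_assoc mul_comm (fun x => (mul_comm _ _).trans (mul_one x))
    (fun x hx => by
      change x * (if hx : x ≠ 0 then (exists_inv x hx).choose else 0) = 1
      rw [dif_pos hx]
      exact (exists_inv x hx).choose_spec)
    (dif_neg (by simp)) mul_add ⟨0, 1, zero_ne⟩
  exact ⟨inferInstance, rfl, rfl, fun _ _ => rfl, fun _ _ => rfl, fun _ => rfl⟩

theorem exists_module {M : Struc.{u}} [Field M.K] (hone : M.kone = 1)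
    (hadd : ∀ x y, M.kadd x y = x + y) (hmul : ∀ x y, M.kmul x y = x * y)
    (h : M.Models vectorSpaceAxioms) :
    ∃ (_ : AddCommGroup M.V) (_ : Module M.K M.V), M.vzero = 0 ∧
      (∀ x y, M.vadd x y = x + y) ∧ (∀ x, M.vneg x = -x) ∧ ∀ x v, M.smul x v = x • v := by
  let _ : Zero M.V := ⟨M.vzero⟩
  let _ : Add M.V := ⟨M.vadd⟩
  let _ : Neg M.V := ⟨M.vneg⟩
  let _ : SMul M.K M.V := ⟨M.smul⟩
  simp only [Struc.Models, vectorSpaceAxioms, Set.mem_insert_iff, Set.mem_singleton_iff,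
    forall_eq_or_imp, forall_eq, realize_close] at h
  obtain ⟨h1, h2, h3, h4, h5, h6, h7, h8⟩ := h
  have add_assoc : ∀ x y z : M.V, x + y + z = x + (y + z) := fun x y z => h1 ![0, 0] ![x, y, z]
  have add_comm : ∀ x y : M.V, x + y = y + x := fun x y => h2 ![0, 0] ![x, y, x]
  have add_zero : ∀ x : M.V, x + 0 = x := fun x => h3 ![0, 0] ![x, x, x]
  have add_neg : ∀ x : M.V, x + -x = 0 := fun x => h4 ![0, 0] ![x, x, x]
  have one_smul : ∀ v : M.V, (1 : M.K) • v = v := fun v => by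
    rw [← hone]; exact h5 ![0, 0] ![v, v, v]
  have mul_smul : ∀ (x y : M.K) (v : M.V), (x * y) • v = x • y • v := fun x y v => by
    rw [← hmul]; exact h6 ![x, y] ![v, v, v]
  have add_smul : ∀ (x y : M.K) (v : M.V), (x + y) • v = x • v + y • v := fun x y v => by
    rw [← hadd]; exact h7 ![x, y] ![v, v, v]
  have smul_add : ∀ (x : M.K) (v w : M.V), x • (v + w) = x • v + x • w := fun x v w =>
    h8 ![x, x] ![v, w, w]
  let _ : AddCommGroup M.V :=
    { AddGroup.ofLeftAxioms add_assoc (fun x => (add_comm _ _).trans (add_zero x))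
        (fun x => (add_comm _ _).trans (add_neg x)) with
      add_comm := add_comm }
  exact ⟨inferInstance, Module.ofMinimalAxioms smul_add add_smul mul_smul one_smul,
    rfl, fun _ _ => rfl, fun _ => rfl, fun _ _ => rfl⟩

/-- Every model of the theory of orthogonal spaces is an orthogonal space. -/
theorem exists_isOrth {M : Struc.{u}} (h : M.Models TO) :
    ∃ (_ : Field M.K) (_ : AddCommGroup M.V) (_ : Module M.K M.V) (Q : QuadraticForm M.K M.V),
      IsOrth M Q := by
  have hTVK : M.Models TVK := fun φ hφ => h φ (Or.inl (Or.inl hφ))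
  obtain ⟨_, kzero, kone, kadd, kmul, kneg⟩ :=
    exists_field fun φ hφ => hTVK φ (Or.inl (Or.inl (Or.inl hφ)))
  obtain ⟨_, _, vzero, vadd, vneg, smul⟩ :=
    exists_module kone kadd kmul fun φ hφ => hTVK φ (Or.inl (Or.inl (Or.inr hφ)))
  have hq : M.Models quadraticFormAxioms := fun φ hφ => h φ (Or.inl (Or.inr hφ))
  simp only [Struc.Models, quadraticFormAxioms, Set.mem_insert_iff, Set.mem_singleton_iff,
    forall_eq_or_imp, forall_eq, realize_close] at hq
  obtain ⟨q1, -, q3, q4, q5⟩ := hq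
  have hβ : ∀ v w : M.V, M.kadd (M.kadd (M.q (M.vadd v w)) (M.kneg (M.q v))) (M.kneg (M.q w)) =
      QuadraticMap.polar M.q v w := by
    intro v w
    simp only [kadd, kneg, vadd, QuadraticMap.polar, sub_eq_add_neg]
  have hsmul : ∀ (x : M.K) (v : M.V), M.q (x • v) = (x * x) • M.q v := fun x v => by
    rw [← smul, smul_eq_mul, ← kmul, ← kmul]
    exact q1 ![x] ![v, v, v]
  have hpadd : ∀ u v w : M.V, QuadraticMap.polar M.q (u + v) w =
      QuadraticMap.polar M.q u w + QuadraticMap.polar M.q v w := fun u v w => by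
    simp only [← hβ, ← vadd, ← kadd]
    exact q3 ![0] ![u, v, w]
  have hpsmul : ∀ (x : M.K) (u v : M.V), QuadraticMap.polar M.q (x • u) v =
      x • QuadraticMap.polar M.q u v := fun x u v => by
    simp only [← hβ, ← smul, smul_eq_mul, ← kmul]
    exact q4 ![x] ![u, v, v]
  have htheta : ∀ (r : ℕ) (v : Fin (r + 1) → M.V), M.theta r v ↔ LinearIndependent M.K v := by
    intro r v
    have := (realize_closeV M _ _ _).1 (hTVK _ (Or.inl (Or.inr ⟨r, rfl⟩))) v
    simp only [realize_iff, realize_closeK, realize_imp, realize_conj] at this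
    refine this.trans ?_
    rw [Fintype.linearIndependent_iff]
    refine forall_congr' fun α => imp_congr ?_ (forall_congr' fun i => ?_)
    · exact iff_of_eq (congrArg₂ _ (valV_vsum_smul M vzero vadd smul kvar vvar α v) vzero)
    · change α i = M.kzero ↔ _
      rw [kzero]
  refine ⟨inferInstance, inferInstance, inferInstance, .ofPolar M.q hsmul hpadd hpsmul, kzero, kone,
    kadd, kmul, kneg, vzero, vadd, vneg, smul, fun _ => rfl, htheta, ?_, ?_, ?_, ?_⟩
  · intro r i v α hv
    have := (realize_close M _).1 (hTVK _ (Or.inr ⟨r, i, Or.inl rfl⟩)) α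
      (Fin.snoc (α := fun _ => M.V) v (∑ j, α j • v j))
    simp only [realize_imp, realize_and] at this
    have hvar : ∀ j : Fin (r + 1), (Fin.snoc (α := fun _ => M.V) v (∑ j, α j • v j) :
        Fin (r + 2) → M.V) j.castSucc = v j := fun j => Fin.snoc_castSucc (α := fun _ => M.V) _ _ _
    have hlast : (Fin.snoc (α := fun _ => M.V) v (∑ j, α j • v j) : Fin (r + 2) → M.V)
        (Fin.last _) = ∑ j, α j • v j := Fin.snoc_last (α := fun _ => M.V) _ _
    have hcoord := this ⟨?_, ?_⟩
    · change M.coord r i (fun j => (Fin.snoc (α := fun _ => M.V) v (∑ j, α j • v j) :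
        Fin (r + 2) → M.V) j.castSucc) ((Fin.snoc (α := fun _ => M.V) v (∑ j, α j • v j) :
        Fin (r + 2) → M.V) (Fin.last _)) = α i at hcoord
      simpa only [hvar, hlast] using hcoord
    · change M.theta r fun j => (Fin.snoc (α := fun _ => M.V) v (∑ j, α j • v j) :
        Fin (r + 2) → M.V) j.castSucc
      simp only [hvar]
      exact (htheta r v).2 hv
    · refine Eq.trans hlast (Eq.symm ((valV_vsum_smul M vzero vadd smul kvar _ α _).trans ?_))
      exact Finset.sum_congr rfl fun j _ => congrArg (α j • ·) (hvar j)
  · intro r i v w hvw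
    have := (realize_closeV M _ _ _).1 (hTVK _ (Or.inr ⟨r, i, Or.inr rfl⟩))
      (Fin.snoc (α := fun _ => M.V) v w)
    simp only [realize_imp, realize_and, realize_not, realize_closeK] at this
    have hvar : ∀ j : Fin (r + 1), (Fin.snoc (α := fun _ => M.V) v w : Fin (r + 2) → M.V)
        j.castSucc = v j := fun j => Fin.snoc_castSucc (α := fun _ => M.V) _ _ _
    have hlast : (Fin.snoc (α := fun _ => M.V) v w : Fin (r + 2) → M.V) (Fin.last _) = w :=
      Fin.snoc_last (α := fun _ => M.V) _ _
    have hcoord := this fun hc => hvw ?_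
    · change M.coord r i (fun j => (Fin.snoc (α := fun _ => M.V) v w : Fin (r + 2) → M.V)
        j.castSucc) ((Fin.snoc (α := fun _ => M.V) v w : Fin (r + 2) → M.V) (Fin.last _)) =
          M.kzero at hcoord
      simpa only [hvar, hlast, kzero] using hcoord
    · obtain ⟨hθ, hc⟩ := hc
      change M.theta r fun j => (Fin.snoc (α := fun _ => M.V) v w : Fin (r + 2) → M.V)
        j.castSucc at hθ
      simp only [hvar] at hθ
      push Not at hc
      obtain ⟨α, hα⟩ := hc
      refine ⟨(htheta r v).1 hθ, α, ?_⟩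
      refine hlast.symm.trans (Eq.trans hα ((valV_vsum_smul M vzero vadd smul kvar _ α _).trans ?_))
      exact Finset.sum_congr rfl fun j _ => congrArg (α j • ·) (hvar j)
  · intro v hv
    have := q5 ![] ![v] fun w => by
      refine (hβ v w).trans ?_
      exact (hv w).trans kzero.symm
    exact this.trans vzero
  · rw [← kadd, ← kone, ← kzero]
    exact h _ (Or.inr rfl)

/-! ### Vectors with prescribed products -/

section Geometry

variable {K V : Type*} [Field K] [AddCommGroup V] [Module K V] {Q : QuadraticForm K V}

open QuadraticMap

/-- A linear functional on the span of independent vectors is represented by the polar form: the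
values of `polar Q (v i) w` can be prescribed. -/
theorem exists_polar_eq (hQ : ∀ v, (∀ w, polar Q v w = 0) → v = 0) {r : ℕ} {v : Fin r → V}
    (hv : LinearIndependent K v) (b : Fin r → K) : ∃ w, ∀ i, polar Q (v i) w = b i := by
  let f : V →ₗ[K] (Fin r → K) := LinearMap.pi fun i => Q.polarBilin (v i)
  suffices h : LinearMap.range f = ⊤ by
    obtain ⟨w, hw⟩ := LinearMap.range_eq_top.1 h b
    exact ⟨w, fun i => congrFun hw i⟩
  by_contra h
  obtain ⟨g, hg, hgf⟩ := Submodule.exists_dual_map_eq_bot_of_lt_top (lt_top_iff_ne_top.2 h)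
    inferInstance
  have hsum : ∑ i, g (Pi.single i 1) • v i = 0 := by
    refine hQ _ fun w => ?_
    have h1 : g (f w) = 0 := by
      have : g (f w) ∈ (LinearMap.range f).map g := ⟨_, ⟨w, rfl⟩, rfl⟩
      rwa [hgf, Submodule.mem_bot] at this
    rw [LinearMap.pi_apply_eq_sum_univ g (f w)] at h1
    have h2 : polar Q (∑ i, g (Pi.single i 1) • v i) w =
        Q.polarBilin (∑ i, g (Pi.single i 1) • v i) w := rfl
    rw [h2, map_sum, LinearMap.sum_apply, ← h1]
    refine Finset.sum_congr rfl fun i _ => ?_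
    rw [map_smul, LinearMap.smul_apply, smul_eq_mul, smul_eq_mul, mul_comm]
    congr 2
    ext j
    simp [Pi.single_apply, eq_comm]
  refine hg (LinearMap.pi_ext' fun i => LinearMap.ext_ring ?_)
  exact Fintype.linearIndependent_iff.1 hv _ hsum i

/-- In infinite dimension, the orthogonal complement of finitely many vectors is not contained in
their span. -/
theorem exists_notMem_span_polar_eq_zero (hdim : ¬ FiniteDimensional K V) {r : ℕ} (v : Fin r → V) :
    ∃ x, x ∉ Submodule.span K (Set.range v) ∧ ∀ i, polar Q (v i) x = 0 := by
  let f : V →ₗ[K] (Fin r → K) := LinearMap.pi fun i => Q.polarBilin (v i)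
  by_contra! h
  have hle : LinearMap.ker f ≤ Submodule.span K (Set.range v) := by
    intro x hx
    by_contra hxv
    obtain ⟨i, hi⟩ := h x hxv
    exact hi (congrFun (LinearMap.mem_ker.1 hx) i)
  have : FiniteDimensional K (Submodule.span K (Set.range v)) :=
    .span_of_finite K (Set.finite_range v)
  have : FiniteDimensional K (LinearMap.ker f) := Submodule.finiteDimensional_of_le hle
  have : FiniteDimensional K (V ⧸ LinearMap.ker f) :=
    Module.Finite.equiv f.quotKerEquivRange.symm
  exact hdim (Module.Finite.of_submodule_quotient (LinearMap.ker f))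

/-- In infinite dimension, over a perfect field of characteristic two, every isometry type of
extension of a finite independent family by one vector is realized. -/
theorem exists_extension (hQ : ∀ v, (∀ w, polar Q v w = 0) → v = 0)
    (hdim : ¬ FiniteDimensional K V) (h2 : (1 + 1 : K) = 0) (hsq : ∀ x : K, ∃ y, y * y = x)
    {r : ℕ} {v : Fin r → V} (hv : LinearIndependent K v) (c : K) (b : Fin r → K) :
    ∃ w, w ∉ Submodule.span K (Set.range v) ∧ Q w = c ∧ ∀ i, polar Q (v i) w = b i := by
  have hself : ∀ x, polar Q x x = 0 := fun x => by
    rw [polar_self, ← one_add_one_eq_two, add_smul, one_smul, ← one_mul (Q x), ← add_mul, h2,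
      zero_mul]
  obtain ⟨w, hw, hwb⟩ : ∃ w, w ∉ Submodule.span K (Set.range v) ∧ ∀ i, polar Q (v i) w = b i := by
    obtain ⟨w, hw⟩ := exists_polar_eq hQ hv b
    by_cases hwv : w ∈ Submodule.span K (Set.range v)
    · obtain ⟨x, hx, hxv⟩ := exists_notMem_span_polar_eq_zero (Q := Q) hdim v
      refine ⟨w + x, fun h => hx ((Submodule.add_mem_iff_right _ hwv).1 h), fun i => ?_⟩
      rw [polar_add_right, hw, hxv, add_zero]
    · exact ⟨w, hwv, hw⟩
  -- It remains to correct `Q w` by a multiple of a vector `z` orthogonal to `v` and `w`.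
  obtain ⟨z, hz, hzQ, hzw, hzv⟩ : ∃ z, z ∉ Submodule.span K (Set.range (Fin.snoc v w : _ → V)) ∧
      Q z ≠ 0 ∧ polar Q w z = 0 ∧ ∀ i, polar Q (v i) z = 0 := by
    have hv' : LinearIndependent K (Fin.snoc v w : _ → V) := linearIndependent_finSnoc.2 ⟨hv, hw⟩
    obtain ⟨x, hx, hxv⟩ := exists_notMem_span_polar_eq_zero (Q := Q) hdim (Fin.snoc v w : _ → V)
    have hspan : ∀ y ∈ Submodule.span K (Set.range (Fin.snoc v w : _ → V)), polar Q x y = 0 := by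
      intro y hy
      induction hy using Submodule.span_induction with
      | mem y hy =>
        obtain ⟨i, rfl⟩ := hy
        rw [polar_comm, hxv]
      | zero => exact polar_zero_right Q x
      | add y z _ _ hy hz => rw [polar_add_right, hy, hz, add_zero]
      | smul a y _ hy => rw [polar_smul_right, hy, smul_zero]
    obtain ⟨y, hy⟩ := exists_polar_eq hQ (linearIndependent_finSnoc.2 ⟨hv', hx⟩)
      (Fin.snoc (0 : Fin (r + 1) → K) 1 : Fin (r + 2) → K)
    have hxy : polar Q x y = 1 := by simpa using hy (Fin.last _)
    have hvy : ∀ i, polar Q ((Fin.snoc v w : Fin (r + 1) → V) i) y = 0 := fun i => by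
      simpa using hy i.castSucc
    -- One of `x`, `y`, `x + y` is not singular, since `Q (x + y) = Q x + Q y + 1`.
    obtain ⟨z, hz, hzQ, hzv⟩ : ∃ z, z ∉ Submodule.span K (Set.range (Fin.snoc v w : _ → V)) ∧
        Q z ≠ 0 ∧ ∀ i, polar Q ((Fin.snoc v w : Fin (r + 1) → V) i) z = 0 := by
      by_cases hx0 : Q x = 0
      · by_cases hy0 : Q y = 0
        · refine ⟨x + y, fun h => ?_, ?_, fun i => ?_⟩
          · have := hspan _ h
            rw [polar_add_right, hself, hxy, zero_add] at this
            exact one_ne_zero this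
          · have : Q (x + y) = 1 := by
              rw [← hxy, polar, hx0, hy0, sub_zero, sub_zero]
            rw [this]
            exact one_ne_zero
          · rw [polar_add_right, hxv, hvy, add_zero]
        · exact ⟨y, fun h => one_ne_zero (hxy.symm.trans (hspan _ h)), hy0, hvy⟩
      · exact ⟨x, hx, hx0, hxv⟩
    exact ⟨z, hz, hzQ, by simpa using hzv (Fin.last _), fun i => by simpa using hzv i.castSucc⟩
  obtain ⟨s, hs⟩ := hsq ((c - Q w) / Q z)
  have hw' : w ∈ Submodule.span K (Set.range (Fin.snoc v w : _ → V)) :=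
    Submodule.subset_span ⟨Fin.last _, by simp⟩
  have hle : Submodule.span K (Set.range v) ≤
      Submodule.span K (Set.range (Fin.snoc v w : Fin (r + 1) → V)) := by
    refine Submodule.span_mono ?_
    rintro _ ⟨i, rfl⟩
    exact ⟨i.castSucc, by simp⟩
  refine ⟨w + s • z, fun h => ?_, ?_, fun i => ?_⟩
  · have hsz : s • z ∈ Submodule.span K (Set.range (Fin.snoc v w : Fin (r + 1) → V)) :=
      (Submodule.add_mem_iff_right _ hw').1 (hle h)
    rcases eq_or_ne s 0 with rfl | hs0
    · rw [zero_smul, add_zero] at h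
      exact hw h
    · exact hz ((Submodule.smul_mem_iff _ hs0).1 hsz)
  · rw [QuadraticMap.map_add Q, polar_smul_right, hzw, smul_zero, add_zero, QuadraticMap.map_smul,
      hs, smul_eq_mul, div_mul_cancel₀ _ hzQ, add_sub_cancel]
  · rw [polar_add_right, polar_smul_right, hzv, smul_zero, add_zero, hwb]

/-- The value of a quadratic form at a linear combination. -/
theorem quadraticForm_sum_smul {r : ℕ} (v : Fin r → V) (c : Fin r → K) :
    Q (∑ i, c i • v i) = ∑ i, c i * c i * Q (v i) +
      ∑ i, ∑ j, if i < j then c i * c j * polar Q (v i) (v j) else 0 := by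
  induction r with
  | zero => simp
  | succ r ih =>
    have hp : polar Q (∑ i : Fin r, c i.castSucc • v i.castSucc) (c (Fin.last r) • v (Fin.last r)) =
        ∑ i : Fin r, c i.castSucc * c (Fin.last r) *
          polar Q (v i.castSucc) (v (Fin.last r)) := by
      rw [← polarBilin_apply_apply, map_sum, LinearMap.sum_apply]
      refine Finset.sum_congr rfl fun i _ => ?_
      rw [polarBilin_apply_apply, polar_smul_left, polar_smul_right, smul_eq_mul, smul_eq_mul,
        mul_assoc]
    rw [Fin.sum_univ_castSucc, QuadraticMap.map_add Q, ih, hp, QuadraticMap.map_smul,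
      Fin.sum_univ_castSucc (n := r), Fin.sum_univ_castSucc (n := r)]
    simp only [Fin.sum_univ_castSucc (n := r), Fin.castSucc_lt_castSucc_iff, Fin.castSucc_lt_last,
      if_true, lt_irrefl, if_false, not_lt_of_gt (Fin.castSucc_lt_last _), Finset.sum_const_zero,
      Finset.sum_add_distrib, smul_eq_mul]
    ring

end Geometry

/-! ### Definability of linear algebra -/

section LinearAlgebra

variable {ι : Type} {s r : ℕ}

theorem definable_linearIndependent {A : Fin s → Fin r → ∀ (K : Type u) [Field K], (ι → K) → K}
    (hA : ∀ j k, DefinableFun (A j k)) :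
    Definable fun K _ a => LinearIndependent K fun j k => A j k K a := by
  have h := Definable.forall_tuple (ι := ι) (κ := Fin s)
    (P := fun K _ a g => (∀ k, ∑ j, g j * A j k K a = 0) → ∀ j, g j = 0)
    (.imp (.forall_index fun k => .eq
        (.sum fun j => .mul (.var (Sum.inr j)) ((hA j k).rename Sum.inl)) .zero)
      (.forall_index fun j => .eq (.var (Sum.inr j)) .zero))
  refine h.congr fun K _ a => ?_
  rw [Fintype.linearIndependent_iff]
  refine forall_congr' fun g => imp_congr_left ?_
  rw [funext_iff]
  simp

/-- The `i`-th coordinate of `w` with respect to the family `A` in `K ^ r`, and zero if `A` is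
dependent or `w` is not in its span. -/
noncomputable def tupleCoord (K : Type u) [Field K] (A : Fin s → Fin r → K) (w : Fin r → K)
    (i : Fin s) : K :=
  open Classical in
  if h : LinearIndependent K A ∧ ∃ α : Fin s → K, w = ∑ j, α j • A j then h.2.choose i else 0

theorem tupleCoord_eq_iff {K : Type u} [Field K] (A : Fin s → Fin r → K) (w : Fin r → K)
    (i : Fin s) (y : K) : tupleCoord K A w i = y ↔
      (LinearIndependent K A ∧ ∃ α : Fin s → K, w = ∑ j, α j • A j ∧ α i = y) ∨
      (¬ (LinearIndependent K A ∧ ∃ α : Fin s → K, w = ∑ j, α j • A j) ∧ y = 0) := by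
  unfold tupleCoord
  split_ifs with h
  · constructor
    · intro hy
      exact Or.inl ⟨h.1, _, h.2.choose_spec, hy⟩
    · rintro (⟨hA, α, hα, rfl⟩ | ⟨hn, -⟩)
      · exact congrFun (hA.fintypeLinearCombination_injective
          (h.2.choose_spec.symm.trans hα)) i
      · exact absurd h hn
  · constructor
    · intro hy
      exact Or.inr ⟨h, hy.symm⟩
    · rintro (⟨hA, α, hα, -⟩ | ⟨-, rfl⟩)
      · exact absurd ⟨hA, α, hα⟩ h
      · rfl

theorem definableFun_tupleCoord {A : Fin s → Fin r → ∀ (K : Type u) [Field K], (ι → K) → K}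
    (hA : ∀ j k, DefinableFun (A j k)) {w : Fin r → ∀ (K : Type u) [Field K], (ι → K) → K}
    (hw : ∀ k, DefinableFun (w k)) (i : Fin s) :
    DefinableFun fun K _ a => tupleCoord K (fun j k => A j k K a) (fun k => w k K a) i := by
  have hA' : ∀ j k, DefinableFun fun (K : Type u) _ (a : Option ι → K) => A j k K (a ∘ some) :=
    fun j k => (hA j k).rename some
  have hw' : ∀ k, DefinableFun fun (K : Type u) _ (a : Option ι → K) => w k K (a ∘ some) :=
    fun k => (hw k).rename some
  have h1 : Definable fun (K : Type u) _ (a : Option ι → K) => ∃ α : Fin s → K,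
      (∀ k, w k K (a ∘ some) = ∑ j, α j * A j k K (a ∘ some)) ∧ α i = a none :=
    .exists_tuple (.and (.forall_index fun k => .eq ((hw' k).rename Sum.inl)
      (.sum fun j => .mul (.var (Sum.inr j)) ((hA' j k).rename Sum.inl)))
      (.eq (.var (Sum.inr i)) (.var (Sum.inl none))))
  have h2 : Definable fun (K : Type u) _ (a : Option ι → K) => ∃ α : Fin s → K,
      ∀ k, w k K (a ∘ some) = ∑ j, α j * A j k K (a ∘ some) :=
    .exists_tuple (.forall_index fun k => .eq ((hw' k).rename Sum.inl)
      (.sum fun j => .mul (.var (Sum.inr j)) ((hA' j k).rename Sum.inl)))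
  have hli := definable_linearIndependent hA'
  refine (Definable.or (hli.and h1)
    (.and (.not (hli.and h2)) (.eq (.var none) .zero))).congr fun K _ a => ?_
  rw [tupleCoord_eq_iff]
  simp only [funext_iff, Finset.sum_apply, Pi.smul_apply, smul_eq_mul]

end LinearAlgebra

/-! ### Reduction to the field over an independent family -/

/-- The variables of the field formula which expresses a property of `m` scalars and of `n`
combinations of `r` independent vectors: the scalars, the coefficients of the combinations, the
values of the quadratic form, and those of its polar form, on the independent vectors. -/
abbrev Idx (m n r : ℕ) : Type := Fin m ⊕ (Fin n × Fin r) ⊕ Fin r ⊕ (Fin r × Fin r)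

/-- An assignment for the variables `Idx m n r`. -/
def assign {K : Type u} {m n r : ℕ} (a : Fin m → K) (c : Fin n → Fin r → K) (q : Fin r → K)
    (p : Fin r → Fin r → K) : Idx m n r → K :=
  Sum.elim a (Sum.elim (fun x => c x.1 x.2) (Sum.elim q fun x => p x.1 x.2))

/-- The assignment given by scalars `a`, coefficients `c`, and the Gram data of the family `v`. -/
def gramAssign {K V : Type u} [Field K] [AddCommGroup V] [Module K V] (Q : QuadraticForm K V)
    {m n r : ℕ} (v : Fin r → V) (a : Fin m → K) (c : Fin n → Fin r → K) : Idx m n r → K :=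
  assign a c (fun i => Q (v i)) fun i j => QuadraticMap.polar Q (v i) (v j)

/-- The vectors `∑ i, c j i • v i`. -/
def combine {K V : Type u} [Field K] [AddCommGroup V] [Module K V] {n r : ℕ} (v : Fin r → V)
    (c : Fin n → Fin r → K) (j : Fin n) : V := ∑ i, c j i • v i

theorem linearIndependent_combine_iff {K V : Type u} [Field K] [AddCommGroup V] [Module K V]
    {n r : ℕ} {v : Fin r → V} (hv : LinearIndependent K v) (c : Fin n → Fin r → K) :
    LinearIndependent K (combine v c) ↔ LinearIndependent K c :=
  (Fintype.linearCombination K v).linearIndependent_iff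
    (LinearMap.ker_eq_bot.2 hv.fintypeLinearCombination_injective) (v := c)

theorem sum_smul_eq_combine_iff {K V : Type u} [Field K] [AddCommGroup V] [Module K V]
    {n r : ℕ} {v : Fin r → V} (hv : LinearIndependent K v) (c : Fin n → Fin r → K)
    (w : Fin r → K) (α : Fin n → K) :
    ∑ i, w i • v i = ∑ j, α j • combine v c j ↔ w = ∑ j, α j • c j := by
  rw [← hv.fintypeLinearCombination_injective.eq_iff, map_sum]
  simp only [map_smul]
  rfl

theorem IsOrth.coord_combine {M : Struc.{u}} [Field M.K] [AddCommGroup M.V] [Module M.K M.V]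
    {Q : QuadraticForm M.K M.V} (hM : IsOrth M Q) {r s : ℕ} {v : Fin r → M.V}
    (hv : LinearIndependent M.K v) (A : Fin (s + 1) → Fin r → M.K) (w : Fin r → M.K)
    (i : Fin (s + 1)) :
    M.coord s i (combine v A) (∑ k, w k • v k) = tupleCoord M.K A w i := by
  symm
  rw [tupleCoord_eq_iff, ← linearIndependent_combine_iff hv]
  simp only [← sum_smul_eq_combine_iff hv]
  by_cases h : LinearIndependent M.K (combine v A) ∧
      ∃ α : Fin (s + 1) → M.K, ∑ k, w k • v k = ∑ j, α j • combine v A j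
  · obtain ⟨hA, α, hα⟩ := h
    refine Or.inl ⟨hA, α, hα, ?_⟩
    rw [hα, hM.coord s i _ α hA]
  · exact Or.inr ⟨h, hM.coord_eq_zero s i _ _ h⟩

/-- On combinations of independent vectors `v`, a term of the field sort takes a value, and a term
of the vector sort has coordinates with respect to `v`, which are definable in the field from the
coefficients and the Gram data of `v`. -/
def Term.Reduces {m n : ℕ} : {s : Srt} → Term m n s → Prop
  | Srt.K, t => ∀ r, ∃ f : ∀ (K : Type u) [Field K], (Idx m n r → K) → K, DefinableFun f ∧
      ∀ (M : Struc.{u}) [Field M.K] [AddCommGroup M.V] [Module M.K M.V]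
        (Q : QuadraticForm M.K M.V), IsOrth M Q → ∀ v : Fin r → M.V, LinearIndependent M.K v →
        ∀ (a : Fin m → M.K) (c : Fin n → Fin r → M.K),
          t.valK M a (combine v c) = f M.K (gramAssign Q v a c)
  | Srt.V, t => ∀ r, ∃ f : Fin r → ∀ (K : Type u) [Field K], (Idx m n r → K) → K,
      (∀ i, DefinableFun (f i)) ∧
      ∀ (M : Struc.{u}) [Field M.K] [AddCommGroup M.V] [Module M.K M.V]
        (Q : QuadraticForm M.K M.V), IsOrth M Q → ∀ v : Fin r → M.V, LinearIndependent M.K v →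
        ∀ (a : Fin m → M.K) (c : Fin n → Fin r → M.K),
          t.valV M a (combine v c) = ∑ i, f i M.K (gramAssign Q v a c) • v i

theorem Term.reduces {m n : ℕ} {s : Srt} (t : Term m n s) : Term.Reduces.{u} t := by
  induction t with
  | kvar i =>
    intro r
    exact ⟨_, .var (Sum.inl i), fun M _ _ _ Q hM v hv a c => rfl⟩
  | vvar j =>
    intro r
    exact ⟨_, fun i => .var (Sum.inr (Sum.inl (j, i))), fun M _ _ _ Q hM v hv a c => rfl⟩
  | kzero =>
    intro r
    exact ⟨_, .zero, fun M _ _ _ Q hM v hv a c => hM.kzero⟩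
  | kone =>
    intro r
    exact ⟨_, .one, fun M _ _ _ Q hM v hv a c => hM.kone⟩
  | kadd t u iht ihu =>
    intro r
    obtain ⟨f, hf, hf'⟩ := iht r
    obtain ⟨g, hg, hg'⟩ := ihu r
    refine ⟨_, hf.add hg, fun M _ _ _ Q hM v hv a c => ?_⟩
    rw [← hf' M Q hM v hv, ← hg' M Q hM v hv, ← hM.kadd]
    rfl
  | kmul t u iht ihu =>
    intro r
    obtain ⟨f, hf, hf'⟩ := iht r
    obtain ⟨g, hg, hg'⟩ := ihu r
    refine ⟨_, hf.mul hg, fun M _ _ _ Q hM v hv a c => ?_⟩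
    rw [← hf' M Q hM v hv, ← hg' M Q hM v hv, ← hM.kmul]
    rfl
  | kneg t iht =>
    intro r
    obtain ⟨f, hf, hf'⟩ := iht r
    refine ⟨_, hf.neg, fun M _ _ _ Q hM v hv a c => ?_⟩
    rw [← hf' M Q hM v hv, ← hM.kneg]
    rfl
  | vzero =>
    intro r
    refine ⟨_, fun i => .zero, fun M _ _ _ Q hM v hv a c => ?_⟩
    simp only [zero_smul, Finset.sum_const_zero]
    exact hM.vzero
  | vadd t u iht ihu =>
    intro r
    obtain ⟨f, hf, hf'⟩ := iht r
    obtain ⟨g, hg, hg'⟩ := ihu r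
    refine ⟨_, fun i => (hf i).add (hg i), fun M _ _ _ Q hM v hv a c => ?_⟩
    simp only [add_smul, Finset.sum_add_distrib]
    rw [← hf' M Q hM v hv, ← hg' M Q hM v hv, ← hM.vadd]
    rfl
  | vneg t iht =>
    intro r
    obtain ⟨f, hf, hf'⟩ := iht r
    refine ⟨_, fun i => (hf i).neg, fun M _ _ _ Q hM v hv a c => ?_⟩
    simp only [neg_smul, Finset.sum_neg_distrib]
    rw [← hf' M Q hM v hv, ← hM.vneg]
    rfl
  | smul t u iht ihu =>
    intro r
    obtain ⟨f, hf, hf'⟩ := iht r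
    obtain ⟨g, hg, hg'⟩ := ihu r
    refine ⟨_, fun i => hf.mul (hg i), fun M _ _ _ Q hM v hv a c => ?_⟩
    simp only [mul_smul, ← Finset.smul_sum]
    rw [← hf' M Q hM v hv, ← hg' M Q hM v hv, ← hM.smul]
    rfl
  | coord s i t u iht ihu =>
    intro r
    choose f hf hf' using fun j => iht j r
    obtain ⟨g, hg, hg'⟩ := ihu r
    refine ⟨_, definableFun_tupleCoord hf hg i, fun M _ _ _ Q hM v hv a c => ?_⟩
    refine Eq.trans ?_ (hM.coord_combine hv (fun j k => f j k M.K (gramAssign Q v a c))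
      (fun k => g k M.K (gramAssign Q v a c)) i)
    rw [← hg' M Q hM v hv]
    exact congrArg (M.coord s i · _) (funext fun j => hf' j M Q hM v hv a c)
  | q t iht =>
    intro r
    obtain ⟨f, hf, hf'⟩ := iht r
    have hpolar : ∀ i j, DefinableFun fun (K : Type u) _ (x : Idx m n r → K) =>
        if i < j then f i K x * f j K x * x (Sum.inr (Sum.inr (Sum.inr (i, j)))) else 0 := by
      intro i j
      split_ifs
      · exact ((hf i).mul (hf j)).mul (.var _)
      · exact .zero
    refine ⟨_, .add (.sum fun i => .mul (.mul (hf i) (hf i))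
        (.var (Sum.inr (Sum.inr (Sum.inl i))))) (.sum fun i => .sum fun j => hpolar i j),
      fun M _ _ _ Q hM v hv a c => ?_⟩
    refine Eq.trans ?_ (quadraticForm_sum_smul (Q := Q) v
      fun i => f i M.K (gramAssign Q v a c))
    rw [← hf' M Q hM v hv, ← hM.q]
    rfl

/-- On combinations of independent vectors `v` of an infinite dimensional orthogonal space over a
perfect field, a formula is equivalent to a field formula in the coefficients and the Gram data
of `v`. -/
def Formula.Reduces {m n : ℕ} (φ : Formula m n) : Prop :=
  ∀ r, ∃ P : ∀ (K : Type u) [Field K], (Idx m n r → K) → Prop, Definable P ∧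
    ∀ (M : Struc.{u}) [Field M.K] [AddCommGroup M.V] [Module M.K M.V]
      (Q : QuadraticForm M.K M.V), IsOrth M Q → ¬ FiniteDimensional M.K M.V →
      (∀ x : M.K, ∃ y, y * y = x) → ∀ v : Fin r → M.V, LinearIndependent M.K v →
      ∀ (a : Fin m → M.K) (c : Fin n → Fin r → M.K),
        φ.Realize M a (combine v c) ↔ P M.K (gramAssign Q v a c)

/-- The coefficients of the combinations `c` and of one more independent vector. -/
def extendCoeff {K : Type u} [Field K] {n r : ℕ} (c : Fin n → Fin r → K) :
    Fin (n + 1) → Fin (r + 1) → K :=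
  Fin.snoc (α := fun _ => Fin (r + 1) → K) (fun j => Fin.snoc (α := fun _ => K) (c j) 0)
    (Fin.snoc (α := fun _ => K) 0 1)

/-- The alternating matrix `p` bordered by `b`. -/
def extendPolar {K : Type u} [Field K] {r : ℕ} (p : Fin r → Fin r → K) (b : Fin r → K) :
    Fin (r + 1) → Fin (r + 1) → K :=
  Fin.snoc (α := fun _ => Fin (r + 1) → K) (fun j => Fin.snoc (α := fun _ => K) (p j) (b j))
    (Fin.snoc (α := fun _ => K) b 0)

theorem combine_extendCoeff {K V : Type u} [Field K] [AddCommGroup V] [Module K V] {n r : ℕ}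
    (v : Fin r → V) (w : V) (c : Fin n → Fin r → K) :
    combine (Fin.snoc (α := fun _ => V) v w) (extendCoeff c) =
      Fin.snoc (α := fun _ => V) (combine v c) w := by
  funext j
  refine Fin.lastCases ?_ (fun j => ?_) j
  · simp [combine, extendCoeff, Fin.sum_univ_castSucc]
  · simp [combine, extendCoeff, Fin.sum_univ_castSucc]

theorem combine_snoc {K V : Type u} [Field K] [AddCommGroup V] [Module K V] {n r : ℕ}
    (v : Fin r → V) (c : Fin n → Fin r → K) (k : Fin r → K) :
    combine v (Fin.snoc (α := fun _ => Fin r → K) c k) =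
      Fin.snoc (α := fun _ => V) (combine v c) (∑ i, k i • v i) := by
  funext j
  refine Fin.lastCases ?_ (fun j => ?_) j <;> simp [combine]

theorem gramAssign_snoc {K V : Type u} [Field K] [AddCommGroup V] [Module K V]
    (h2 : (1 + 1 : K) = 0) (Q : QuadraticForm K V) {m n r : ℕ} (v : Fin r → V) (w : V)
    (a : Fin m → K) (c : Fin n → Fin r → K) :
    gramAssign Q (Fin.snoc (α := fun _ => V) v w) a (extendCoeff c) =
      assign a (extendCoeff c) (Fin.snoc (α := fun _ => K) (fun i => Q (v i)) (Q w))
        (extendPolar (fun i j => QuadraticMap.polar Q (v i) (v j))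
          fun i => QuadraticMap.polar Q (v i) w) := by
  unfold gramAssign
  congr 1
  · funext i
    refine Fin.lastCases ?_ (fun i => ?_) i <;> simp
  · funext i j
    refine Fin.lastCases ?_ (fun i => ?_) i <;> refine Fin.lastCases ?_ (fun j => ?_) j <;>
      simp only [extendPolar, Fin.snoc_castSucc, Fin.snoc_last]
    · rw [QuadraticMap.polar_self, ← one_add_one_eq_two, add_smul, one_smul, ← one_mul (Q w),
        ← add_mul, h2, zero_mul]
    · exact QuadraticMap.polar_comm _ _ _

theorem definable_forall_snoc {m n r : ℕ}
    {P : ∀ (K : Type u) [Field K], (Idx m (n + 1) r → K) → Prop} (hP : Definable P) :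
    Definable fun K _ (x : Idx m n r → K) => ∀ k : Fin r → K,
      P K (assign (fun i => x (Sum.inl i)) (Fin.snoc (α := fun _ => Fin r → K)
        (fun j i => x (Sum.inr (Sum.inl (j, i)))) k) (fun i => x (Sum.inr (Sum.inr (Sum.inl i))))
        fun i j => x (Sum.inr (Sum.inr (Sum.inr (i, j))))) := by
  refine .forall_tuple (hP.comp (f := fun l K _ x => assign _ _ _ _ l) fun l => ?_)
  obtain i | ⟨j, i⟩ | i | ⟨i, j⟩ := l
  · exact .var (Sum.inl (Sum.inl i))
  · refine Fin.lastCases ?_ (fun j => ?_) j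
    · simpa [assign] using DefinableFun.var (Sum.inr i : Idx m n r ⊕ Fin r)
    · simpa [assign] using
        DefinableFun.var (Sum.inl (Sum.inr (Sum.inl (j, i))) : Idx m n r ⊕ Fin r)
  · exact .var (Sum.inl (Sum.inr (Sum.inr (Sum.inl i))))
  · exact .var (Sum.inl (Sum.inr (Sum.inr (Sum.inr (i, j)))))

theorem definable_forall_extend {m n r : ℕ}
    {P : ∀ (K : Type u) [Field K], (Idx m (n + 1) (r + 1) → K) → Prop} (hP : Definable P) :
    Definable fun K _ (x : Idx m n r → K) => ∀ y : Option (Fin r) → K,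
      P K (assign (fun i => x (Sum.inl i)) (extendCoeff fun j i => x (Sum.inr (Sum.inl (j, i))))
        (Fin.snoc (α := fun _ => K) (fun i => x (Sum.inr (Sum.inr (Sum.inl i)))) (y none))
        (extendPolar (fun i j => x (Sum.inr (Sum.inr (Sum.inr (i, j))))) fun i => y (some i))) := by
  refine .forall_tuple (hP.comp (f := fun l K _ x => assign _ _ _ _ l) fun l => ?_)
  obtain i | ⟨j, i⟩ | i | ⟨i, j⟩ := l
  · exact .var (Sum.inl (Sum.inl i))
  · refine Fin.lastCases ?_ (fun j => ?_) j <;> refine Fin.lastCases ?_ (fun i => ?_) i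
    · simpa [assign, extendCoeff] using DefinableFun.one
    · simpa [assign, extendCoeff] using DefinableFun.zero
    · simpa [assign, extendCoeff] using DefinableFun.zero
    · simpa [assign, extendCoeff] using
        DefinableFun.var (Sum.inl (Sum.inr (Sum.inl (j, i))) : Idx m n r ⊕ Option (Fin r))
  · refine Fin.lastCases ?_ (fun i => ?_) i
    · simpa [assign] using DefinableFun.var (Sum.inr none : Idx m n r ⊕ Option (Fin r))
    · simpa [assign] using DefinableFun.var
        (Sum.inl (Sum.inr (Sum.inr (Sum.inl i))) : Idx m n r ⊕ Option (Fin r))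
  · refine Fin.lastCases ?_ (fun i => ?_) i <;> refine Fin.lastCases ?_ (fun j => ?_) j
    · simpa [assign, extendPolar] using DefinableFun.zero
    · simpa [assign, extendPolar] using
        DefinableFun.var (Sum.inr (some j) : Idx m n r ⊕ Option (Fin r))
    · simpa [assign, extendPolar] using
        DefinableFun.var (Sum.inr (some i) : Idx m n r ⊕ Option (Fin r))
    · simpa [assign, extendPolar] using DefinableFun.var
        (Sum.inl (Sum.inr (Sum.inr (Sum.inr (i, j)))) : Idx m n r ⊕ Option (Fin r))

theorem Formula.reduces {m n : ℕ} (φ : Formula m n) : Formula.Reduces.{u} φ := by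
  induction φ with
  | bot =>
    intro r
    exact ⟨_, .false, fun M _ _ _ Q hM hdim hsq v hv a c => Iff.rfl⟩
  | eqK t u =>
    intro r
    obtain ⟨f, hf, hf'⟩ := t.reduces r
    obtain ⟨g, hg, hg'⟩ := u.reduces r
    refine ⟨_, Definable.eq hf hg, fun M _ _ _ Q hM hdim hsq v hv a c => ?_⟩
    rw [← hf' M Q hM v hv, ← hg' M Q hM v hv]
    rfl
  | eqV t u =>
    intro r
    obtain ⟨f, hf, hf'⟩ := t.reduces r
    obtain ⟨g, hg, hg'⟩ := u.reduces r
    refine ⟨_, .forall_index fun i => .eq (hf i) (hg i), fun M _ _ _ Q hM hdim hsq v hv a c => ?_⟩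
    change t.valV M a (combine v c) = u.valV M a (combine v c) ↔ _
    rw [hf' M Q hM v hv, hg' M Q hM v hv, ← funext_iff,
      ← hv.fintypeLinearCombination_injective.eq_iff]
    rfl
  | theta s t =>
    intro r
    choose f hf hf' using fun j => (t j).reduces r
    refine ⟨_, definable_linearIndependent hf, fun M _ _ _ Q hM hdim hsq v hv a c => ?_⟩
    rw [← linearIndependent_combine_iff hv, ← hM.theta]
    exact iff_of_eq (congrArg (M.theta s) (funext fun j => hf' j M Q hM v hv a c))
  | imp φ ψ ihφ ihψ =>
    intro r
    obtain ⟨P, hP, hP'⟩ := ihφ r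
    obtain ⟨P', hP₂, hP₂'⟩ := ihψ r
    exact ⟨_, hP.imp hP₂, fun M _ _ _ Q hM hdim hsq v hv a c =>
      imp_congr (hP' M Q hM hdim hsq v hv a c) (hP₂' M Q hM hdim hsq v hv a c)⟩
  | @allK m n φ ih =>
    intro r
    obtain ⟨P, hP, hP'⟩ := ih r
    refine ⟨_, .all (P := fun K _ (x : Idx m n r → K) y => P K (Sum.elim
        (Fin.snoc (α := fun _ => K) (fun i => x (Sum.inl i)) y) fun l => x (Sum.inr l))) ?_,
      fun M _ _ _ Q hM hdim hsq v hv a c => forall_congr' fun x =>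
        hP' M Q hM hdim hsq v hv _ c⟩
    refine (hP.rename (Sum.elim (Fin.lastCases (none : Option (Idx m n r)) fun i =>
      some (Sum.inl i)) fun l => some (Sum.inr l))).congr fun K _ x => iff_of_eq ?_
    congr 1
    funext l
    obtain i | l := l
    · refine Fin.lastCases ?_ (fun i => ?_) i <;> simp
    · rfl
  | allV φ ih =>
    intro r
    obtain ⟨P, hP, hP'⟩ := ih r
    obtain ⟨P₂, hP₂, hP₂'⟩ := ih (r + 1)
    refine ⟨_, (definable_forall_snoc hP).and (definable_forall_extend hP₂),
      fun M _ _ _ Q hM hdim hsq v hv a c => ?_⟩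
    -- A vector in the span of `v` is given by its coordinates, and one outside the span by its
    -- Gram data with `v`, which are arbitrary.
    constructor
    · refine fun h => ⟨fun k => ?_, fun y => ?_⟩
      · refine (hP' M Q hM hdim hsq v hv a (Fin.snoc (α := fun _ => Fin r → M.K) c k)).1 ?_
        rw [combine_snoc]
        exact h _
      · obtain ⟨w, hw, hQ, hp⟩ := exists_extension hM.nondegenerate hdim hM.two_eq_zero hsq hv
          (y none) fun i => y (some i)
        have := (hP₂' M Q hM hdim hsq _ (linearIndependent_finSnoc.2 ⟨hv, hw⟩) a
          (extendCoeff c)).1 (by rw [combine_extendCoeff]; exact h w)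
        rw [gramAssign_snoc hM.two_eq_zero, hQ, funext hp] at this
        exact this
    · rintro ⟨h1, h2⟩ w
      by_cases hw : w ∈ Submodule.span M.K (Set.range v)
      · obtain ⟨k, rfl⟩ := (Submodule.mem_span_range_iff_exists_fun _).1 hw
        rw [← combine_snoc]
        exact (hP' M Q hM hdim hsq v hv a (Fin.snoc (α := fun _ => Fin r → M.K) c k)).2 (h1 k)
      · rw [← combine_extendCoeff]
        refine (hP₂' M Q hM hdim hsq _ (linearIndependent_finSnoc.2 ⟨hv, hw⟩) a
          (extendCoeff c)).2 ?_
        rw [gramAssign_snoc hM.two_eq_zero]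
        exact h2 fun o => o.elim (Q w) fun i => QuadraticMap.polar Q (v i) w

/-! ### Quantifier elimination for algebraically closed fields -/

open PrimeSpectrum in
/-- A point of `Spec R[X]` above the kernel of a ring homomorphism `g` to an algebraically closed
field `K` gives a solution in some extension of `K`, and so one in `K`. -/
theorem exists_eval₂_of_prime {R : Type*} [CommRing R] {K : Type*} [Field K] [IsAlgClosed K]
    (g : R →+* K) (P : Ideal (Polynomial R)) [P.IsPrime] (hP : P.comap Polynomial.C = RingHom.ker g)
    {ι : Type*} (p : ι → Polynomial R) (hp : ∀ i, p i ∈ P) (f : Polynomial R) (hf : f ∉ P) :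
    ∃ x : K, (∀ i, (p i).eval₂ g x = 0) ∧ f.eval₂ g x ≠ 0 := by
  have : (RingHom.ker g).IsPrime := RingHom.ker_isPrime g
  let F := (RingHom.ker g).ResidueField
  let E := P.ResidueField
  let i₁ : F →+* K := Ideal.ResidueField.lift (RingHom.ker g) g le_rfl fun x hx =>
    IsUnit.mk0 _ hx
  let i₂ : F →+* E := Ideal.ResidueField.map (RingHom.ker g) P Polynomial.C hP.symm
  algebraize [i₁, i₂]
  -- A residue field of `K ⊗ E` is a common extension of `K` and of the residue field `E` of `P`.
  obtain ⟨m, hm⟩ := Ideal.exists_maximal (TensorProduct F K E)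
  let _ : Field (TensorProduct F K E ⧸ m) := Ideal.Quotient.field m
  let j₁ : K →+* TensorProduct F K E ⧸ m :=
    (Ideal.Quotient.mk m).comp (Algebra.TensorProduct.includeLeftRingHom)
  let j₂ : Polynomial R →+* TensorProduct F K E ⧸ m :=
    ((Ideal.Quotient.mk m).comp
      (Algebra.TensorProduct.includeRight : E →ₐ[F] TensorProduct F K E).toRingHom).comp
      (algebraMap (Polynomial R) E)
  have hker : ∀ h, j₂ h = 0 ↔ h ∈ P := fun h => by
    rw [← Ideal.algebraMap_residueField_eq_zero]
    exact map_eq_zero ((Ideal.Quotient.mk m).comp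
      (Algebra.TensorProduct.includeRight : E →ₐ[F] TensorProduct F K E).toRingHom)
  have hj : j₂.comp Polynomial.C = j₁.comp g := by
    ext r
    have h1 : g r = algebraMap F K (algebraMap R F r) :=
      (Ideal.ResidueField.lift_algebraMap (RingHom.ker g) g _ _ r).symm
    have h2 : algebraMap (Polynomial R) E (Polynomial.C r) = algebraMap F E (algebraMap R F r) :=
      (Ideal.ResidueField.map_algebraMap _ _ _ _ r).symm
    simp only [j₁, j₂, RingHom.comp_apply, h1, h2]
    congr 1
    exact ((Algebra.TensorProduct.includeRight : E →ₐ[F] TensorProduct F K E).commutes _).trans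
      ((Algebra.TensorProduct.includeLeft : K →ₐ[F] TensorProduct F K E).commutes _).symm
  have hev : ∀ h, j₂ h = (h.map g).eval₂ j₁ (j₂ Polynomial.X) := fun h => by
    rw [Polynomial.eval₂_map, ← hj, ← Polynomial.hom_eval₂, Polynomial.eval₂_C_X]
  by_cases hx : ∃ x : K, j₁ x = j₂ Polynomial.X
  · obtain ⟨x, hx⟩ := hx
    have hev' : ∀ h : Polynomial R, h.eval₂ g x = 0 ↔ h ∈ P := fun h => by
      rw [← hker, hev, ← hx, Polynomial.eval₂_at_apply, map_eq_zero, Polynomial.eval_map]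
    exact ⟨x, fun i => (hev' _).2 (hp i), fun h => hf ((hev' _).1 h)⟩
  · -- If the point is not in `K`, then it is transcendental over `K`.
    have hp0 : ∀ i, (p i).map g = 0 := fun i => by
      by_contra h0
      have h := (hev (p i)).symm.trans ((hker _).2 (hp i))
      exact hx ((IsAlgClosed.splits ((p i).map g)).mem_range_of_isRoot h0
        (by rwa [Polynomial.IsRoot, Polynomial.eval_map]))
    have hf0 : f.map g ≠ 0 := fun h => hf ((hker f).1 (by rw [hev, h, Polynomial.eval₂_zero]))
    obtain ⟨x, hx⟩ : ∃ x, (f.map g).eval x ≠ 0 := by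
      by_contra! h
      exact hf0 (Polynomial.funext fun x => by rw [h, Polynomial.eval_zero])
    refine ⟨x, fun i => ?_, by rwa [← Polynomial.eval_map]⟩
    rw [← Polynomial.eval_map, hp0, Polynomial.eval_zero]

open PrimeSpectrum in
/-- Projecting a constructible subset of the affine line over `R` amounts, at points with values in
an algebraically closed field, to quantifying over the field. -/
theorem comap_bot_mem_image_iff {R : Type*} [CommRing R] {K : Type*} [Field K] [IsAlgClosed K]
    (g : R →+* K) (S : ConstructibleSetData (Polynomial R)) :
    comap g ⊥ ∈ comap Polynomial.C '' S.toSet ↔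
      ∃ x : K, comap (Polynomial.eval₂RingHom g x) ⊥ ∈ S.toSet := by
  constructor
  · rintro ⟨P, hP, hPg⟩
    simp only [ConstructibleSetData.toSet, Set.mem_iUnion] at hP
    obtain ⟨C, hC, hCP, hCf⟩ := hP
    have hPg' : P.asIdeal.comap Polynomial.C = RingHom.ker g := congrArg PrimeSpectrum.asIdeal hPg
    obtain ⟨x, hx, hfx⟩ := exists_eval₂_of_prime g P.asIdeal hPg' C.g
      (fun i => hCP ⟨i, rfl⟩) C.f fun h => hCf (by simpa using h)
    refine ⟨x, ?_⟩
    simp only [ConstructibleSetData.toSet, Set.mem_iUnion]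
    refine ⟨C, hC, ?_, fun h => hfx (h rfl)⟩
    rintro _ ⟨i, rfl⟩
    exact hx i
  · rintro ⟨x, hx⟩
    refine ⟨_, hx, ?_⟩
    rw [← comap_comp_apply]
    congr 1
    ext; simp

namespace FieldFormula

/-- Quantifier-free formulas. -/
def IsQF : {ι : Type} → FieldFormula ι → Prop
  | _, zero _ => True
  | _, imp φ ψ => φ.IsQF ∧ ψ.IsQF
  | _, all _ => False

variable {ι : Type}

/-- The point of the affine space `Spec ℤ[X_i]` under the `K`-point `a`. -/
noncomputable def point (K : Type u) [Field K] (a : ι → K) : PrimeSpectrum (MvPolynomial ι ℤ) :=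
  PrimeSpectrum.comap (MvPolynomial.aeval a : MvPolynomial ι ℤ →ₐ[ℤ] K).toRingHom ⊥

theorem mem_point (K : Type u) [Field K] (a : ι → K) (p : MvPolynomial ι ℤ) :
    p ∈ (point K a).asIdeal ↔ MvPolynomial.aeval a p = 0 := Iff.rfl

open PrimeSpectrum in
/-- A formula defines a constructible subset of affine space over `ℤ`, uniformly in all
algebraically closed fields: Chevalley's theorem takes care of the quantifiers. -/
theorem exists_isConstructible (φ : FieldFormula ι) :
    ∃ C : Set (PrimeSpectrum (MvPolynomial ι ℤ)), Topology.IsConstructible C ∧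
      ∀ (K : Type u) [Field K] [IsAlgClosed K] (a : ι → K), φ.Realize K a ↔ point K a ∈ C := by
  induction φ with
  | zero p =>
    refine ⟨zeroLocus {p}, ?_, fun K _ _ a => ?_⟩
    · rw [← Topology.isConstructible_compl, ← basicOpen_eq_zeroLocus_compl]
      exact isConstructible_basicOpen
    · simp [mem_point, Realize]
  | imp φ ψ ihφ ihψ =>
    obtain ⟨C, hC, hC'⟩ := ihφ
    obtain ⟨D, hD, hD'⟩ := ihψ
    refine ⟨Cᶜ ∪ D, (Topology.isConstructible_compl.2 hC).union hD, fun K _ _ a => ?_⟩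
    rw [Set.mem_union, Set.mem_compl_iff, ← hC', ← hD', ← imp_iff_not_or]
    rfl
  | @all ι φ ih =>
    obtain ⟨C, hC, hC'⟩ := ih
    obtain ⟨S, hS⟩ := exists_constructibleSetData_iff.2 (Topology.isConstructible_compl.2 hC)
    let e : MvPolynomial (Option ι) ℤ →+* Polynomial (MvPolynomial ι ℤ) :=
      (MvPolynomial.optionEquivLeft ℤ ι).toAlgHom.toRingHom
    refine ⟨(comap Polynomial.C '' (S.map e).toSet)ᶜ, Topology.isConstructible_compl.2
      (isConstructible_comap_C (S.map e).isConstructible_toSet), fun K _ _ a => ?_⟩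
    rw [Set.mem_compl_iff, point, comap_bot_mem_image_iff, not_exists]
    refine forall_congr' fun x => ?_
    rw [hC', ConstructibleSetData.toSet_map, hS, Set.mem_preimage, Set.mem_compl_iff, not_not,
      ← comap_comp_apply]
    have h : (Polynomial.eval₂RingHom (MvPolynomial.aeval a : MvPolynomial ι ℤ →ₐ[ℤ] K).toRingHom
        x).comp e = (MvPolynomial.aeval fun o : Option ι => o.elim x a :
          MvPolynomial (Option ι) ℤ →ₐ[ℤ] K).toRingHom := by
      refine MvPolynomial.ringHom_ext (fun n => by simp) fun o => ?_
      cases o <;> simp [e]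
    rw [h, point]

theorem exists_isQF_forall_mem (s : Finset (MvPolynomial ι ℤ)) :
    ∃ φ : FieldFormula ι, φ.IsQF ∧ ∀ (K : Type u) [Field K] (a : ι → K),
      φ.Realize K a ↔ ∀ p ∈ s, MvPolynomial.aeval a p = 0 := by
  classical
  induction s using Finset.induction_on with
  | empty => exact ⟨zero 0, trivial, fun K _ a => by simp [Realize]⟩
  | insert p s _ ih =>
    obtain ⟨φ, hφ, hφ'⟩ := ih
    refine ⟨((zero p).imp (φ.imp (zero 1))).imp (zero 1), ⟨⟨trivial, hφ, trivial⟩, trivial⟩,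
      fun K _ a => ?_⟩
    simp [Realize, hφ']

open PrimeSpectrum in
theorem exists_isQF_mem_toSet (S : ConstructibleSetData (MvPolynomial ι ℤ)) :
    ∃ φ : FieldFormula ι, φ.IsQF ∧ ∀ (K : Type u) [Field K] (a : ι → K),
      φ.Realize K a ↔ point K a ∈ S.toSet := by
  classical
  induction S using Finset.induction_on with
  | empty => exact ⟨zero 1, trivial, fun K _ a => by simp [Realize, ConstructibleSetData.toSet]⟩
  | insert C S _ ih =>
    obtain ⟨φ, hφ, hφ'⟩ := ih
    obtain ⟨ψ, hψ, hψ'⟩ := exists_isQF_forall_mem.{u} (Finset.univ.image C.g)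
    refine ⟨(ψ.imp (zero C.f)).imp φ, ⟨⟨hψ, trivial⟩, hφ⟩, fun K _ a => ?_⟩
    have hC : point K a ∈ C.toSet ↔ (∀ i, MvPolynomial.aeval a (C.g i) = 0) ∧
        MvPolynomial.aeval a C.f ≠ 0 := by
      simp [BasicConstructibleSetData.toSet, Set.range_subset_iff, mem_point]
    simp only [ConstructibleSetData.toSet] at hφ' ⊢
    rw [Finset.set_biUnion_insert, Set.mem_union, hC, ← hφ']
    simp only [Realize, hψ', Finset.mem_image, Finset.mem_univ, true_and, forall_exists_index,
      forall_apply_eq_imp_iff]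
    tauto

/-- Quantifier elimination for algebraically closed fields. -/
theorem exists_isQF_of_isAlgClosed (φ : FieldFormula ι) :
    ∃ ψ : FieldFormula ι, ψ.IsQF ∧ ∀ (K : Type u) [Field K] [IsAlgClosed K] (a : ι → K),
      ψ.Realize K a ↔ φ.Realize K a := by
  obtain ⟨C, hC, hC'⟩ := exists_isConstructible.{u} φ
  obtain ⟨S, rfl⟩ := PrimeSpectrum.exists_constructibleSetData_iff.2 hC
  obtain ⟨ψ, hψ, hψ'⟩ := exists_isQF_mem_toSet.{u} S
  exact ⟨ψ, hψ, fun K _ _ a => (hψ' K a).trans (hC' K a).symm⟩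

end FieldFormula

/-! ### Field formulas as formulas of the language of orthogonal spaces -/

theorem Term.val_subst (M : Struc.{u}) {m n m' n' : ℕ} (f : Fin m → Term m' n' Srt.K)
    (g : Fin n → Term m' n' Srt.V) (a : Fin m' → M.K) (b : Fin n' → M.V) {s : Srt}
    (t : Term m n s) :
    (t.subst f g).val M a b = t.val M (fun i => (f i).valK M a b) fun j => (g j).valV M a b := by
  induction t with
  | kvar i => rfl
  | vvar j => rfl
  | kzero => rfl
  | kone => rfl
  | kadd t u iht ihu => exact congrArg₂ M.kadd iht ihu
  | kmul t u iht ihu => exact congrArg₂ M.kmul iht ihu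
  | kneg t iht => exact congrArg M.kneg iht
  | vzero => rfl
  | vadd t u iht ihu => exact congrArg₂ M.vadd iht ihu
  | vneg t iht => exact congrArg M.vneg iht
  | smul t u iht ihu => exact congrArg₂ M.smul iht ihu
  | coord r i t u iht ihu => exact congrArg₂ (M.coord r i) (funext iht) ihu
  | q t iht => exact congrArg M.q iht

theorem Term.val_liftK (M : Struc.{u}) {m n : ℕ} (a : Fin m → M.K) (b : Fin n → M.V) (x : M.K)
    {s : Srt} (t : Term m n s) :
    t.liftK.val M (Fin.snoc (α := fun _ => M.K) a x) b = t.val M a b := by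
  refine (Term.val_subst M _ _ _ _ t).trans ?_
  congr 1
  exact funext fun i => Fin.snoc_castSucc (α := fun _ => M.K) _ _ _

theorem Term.val_liftV (M : Struc.{u}) {m n : ℕ} (a : Fin m → M.K) (b : Fin n → M.V) (v : M.V)
    {s : Srt} (t : Term m n s) :
    t.liftV.val M a (Fin.snoc (α := fun _ => M.V) b v) = t.val M a b := by
  refine (Term.val_subst M _ _ _ _ t).trans ?_
  congr 1
  exact funext fun i => Fin.snoc_castSucc (α := fun _ => M.V) _ _ _

theorem Formula.realize_subst (M : Struc.{u}) {m n m' n' : ℕ} (φ : Formula m n)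
    (f : Fin m → Term m' n' Srt.K) (g : Fin n → Term m' n' Srt.V) (a : Fin m' → M.K)
    (b : Fin n' → M.V) : (φ.subst f g).Realize M a b ↔
      φ.Realize M (fun i => (f i).valK M a b) fun j => (g j).valV M a b := by
  induction φ generalizing m' n' with
  | bot => rfl
  | eqK t u => exact iff_of_eq (congrArg₂ _ (t.val_subst M f g a b) (u.val_subst M f g a b))
  | eqV t u => exact iff_of_eq (congrArg₂ _ (t.val_subst M f g a b) (u.val_subst M f g a b))
  | theta r t =>
    exact iff_of_eq (congrArg (M.theta r) (funext fun j => (t j).val_subst M f g a b))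
  | imp φ ψ ihφ ihψ => exact imp_congr (ihφ f g a b) (ihψ f g a b)
  | allK φ ih =>
    refine forall_congr' fun x => (ih _ _ _ _).trans (iff_of_eq ?_)
    congr 1
    · funext i
      refine Fin.lastCases ?_ (fun i => ?_) i
      · simp only [Fin.snoc_last]
        exact Fin.snoc_last (α := fun _ => M.K) _ _
      · simp only [Fin.snoc_castSucc]
        exact (f i).val_liftK M a b x
    · exact funext fun j => (g j).val_liftK M a b x
  | allV φ ih =>
    refine forall_congr' fun v => (ih _ _ _ _).trans (iff_of_eq ?_)
    congr 1
    · exact funext fun i => (f i).val_liftV M a b v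
    · funext j
      refine Fin.lastCases ?_ (fun j => ?_) j
      · simp only [Fin.snoc_last]
        exact Fin.snoc_last (α := fun _ => M.V) _ _
      · simp only [Fin.snoc_castSucc]
        exact (g j).val_liftV M a b v

theorem Formula.IsQF.subst {m n m' n' : ℕ} {φ : Formula m n} (hφ : φ.IsQF)
    (f : Fin m → Term m' n' Srt.K) (g : Fin n → Term m' n' Srt.V) : (φ.subst f g).IsQF := by
  induction φ generalizing m' n' with
  | bot => trivial
  | eqK t u => trivial
  | eqV t u => trivial
  | theta r t => trivial
  | imp φ ψ ihφ ihψ => exact ⟨ihφ hφ.1 f g, ihψ hφ.2 f g⟩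
  | allK φ ih => exact hφ.elim
  | allV φ ih => exact hφ.elim

theorem exists_isRing_term {ι : Type} (p : MvPolynomial ι ℤ) {m : ℕ} (e : ι → Fin m) :
    ∃ t : Term m 0 Srt.K, t.IsRing ∧ ∀ (M : Struc.{u}) [Field M.K] [AddCommGroup M.V]
      [Module M.K M.V] (Q : QuadraticForm M.K M.V), IsOrth M Q → ∀ (a : Fin m → M.K)
      (b : Fin 0 → M.V), t.valK M a b = MvPolynomial.aeval (a ∘ e) p := by
  induction p using MvPolynomial.induction_on with
  | C z =>
    induction z using Int.induction_on with
    | zero => exact ⟨kzero, trivial, fun M _ _ _ Q hM a b => hM.kzero.trans (by simp)⟩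
    | succ n ih =>
      obtain ⟨t, ht, ht'⟩ := ih
      refine ⟨t.kadd kone, ⟨ht, trivial⟩, fun M _ _ _ Q hM a b => ?_⟩
      rw [map_add, map_add, ← ht' M Q hM a b, map_one, map_one, ← hM.kone, ← hM.kadd]
      rfl
    | pred n ih =>
      obtain ⟨t, ht, ht'⟩ := ih
      refine ⟨t.kadd kone.kneg, ⟨ht, trivial⟩, fun M _ _ _ Q hM a b => ?_⟩
      rw [map_sub, map_sub, ← ht' M Q hM a b, map_one, map_one, sub_eq_add_neg, ← hM.kone,
        ← hM.kneg, ← hM.kadd]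
      rfl
  | add p q ihp ihq =>
    obtain ⟨t, ht, ht'⟩ := ihp
    obtain ⟨u, hu, hu'⟩ := ihq
    refine ⟨t.kadd u, ⟨ht, hu⟩, fun M _ _ _ Q hM a b => ?_⟩
    rw [map_add, ← ht' M Q hM a b, ← hu' M Q hM a b, ← hM.kadd]
    rfl
  | mul_X p i ihp =>
    obtain ⟨t, ht, ht'⟩ := ihp
    refine ⟨t.kmul (kvar (e i)), ⟨ht, trivial⟩, fun M _ _ _ Q hM a b => ?_⟩
    rw [map_mul, ← ht' M Q hM a b, MvPolynomial.aeval_X, ← hM.kmul]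
    rfl

/-- Every field formula is, after a renaming `e` of its variables, a formula of the language of
rings in the sense of the two-sorted language. -/
theorem FieldFormula.exists_isRing {ι : Type} (θ : FieldFormula ι) {m : ℕ} (e : ι → Fin m) :
    ∃ ψ : Formula m 0, ψ.IsRing ∧ (θ.IsQF → ψ.IsQF) ∧ ∀ (M : Struc.{u}) [Field M.K]
      [AddCommGroup M.V] [Module M.K M.V] (Q : QuadraticForm M.K M.V), IsOrth M Q →
      ∀ (a : Fin m → M.K) (b : Fin 0 → M.V), ψ.Realize M a b ↔ θ.Realize M.K (a ∘ e) := by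
  induction θ generalizing m with
  | zero p =>
    obtain ⟨t, ht, ht'⟩ := exists_isRing_term.{u} p e
    refine ⟨eqK t kzero, ⟨ht, trivial⟩, fun _ => trivial, fun M _ _ _ Q hM a b => ?_⟩
    exact iff_of_eq (congrArg₂ _ (ht' M Q hM a b) hM.kzero)
  | imp θ₁ θ₂ ih₁ ih₂ =>
    obtain ⟨ψ₁, h₁, hq₁, h₁'⟩ := ih₁ e
    obtain ⟨ψ₂, h₂, hq₂, h₂'⟩ := ih₂ e
    exact ⟨ψ₁.imp ψ₂, ⟨h₁, h₂⟩, fun h => ⟨hq₁ h.1, hq₂ h.2⟩, fun M _ _ _ Q hM a b =>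
      imp_congr (h₁' M Q hM a b) (h₂' M Q hM a b)⟩
  | all θ ih =>
    obtain ⟨ψ, h, -, h'⟩ := ih fun o => o.elim (Fin.last m) fun i => (e i).castSucc
    refine ⟨ψ.allK, h, False.elim, fun M _ _ _ Q hM a b => forall_congr' fun x => ?_⟩
    rw [h' M Q hM]
    refine iff_of_eq (congrArg _ (funext fun o => ?_))
    cases o <;> simp

/-! ### Elimination of quantifiers -/

section Selection

variable {m n : ℕ}

/-- The term for the `i`-th coordinate of the vector variable `v_j` with respect to the vector
variables selected by `s`. -/
def coordTerm : {r : ℕ} → (Fin r → Fin n) → Fin n → Fin r → Term m n Srt.K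
  | 0, _, _ => Fin.elim0
  | r + 1, s, j => fun i => coord r i (fun k => vvar (s k)) (vvar j)

/-- The vector variables selected by `s` are linearly independent. -/
def indepFormula : {r : ℕ} → (Fin r → Fin n) → Formula m n
  | 0, _ => bot.not
  | r + 1, s => theta r fun k => vvar (s k)

/-- The vector variables selected by `s` form a basis of the span of all vector variables. -/
def basisFormula {r : ℕ} (s : Fin r → Fin n) : Formula m n :=
  (indepFormula s).and <| conj fun j : Fin n =>
    eqV (vvar j) (vsum fun i =>
      (coordTerm s j i : Term m n Srt.K) • (vvar (s i) : Term m n Srt.V))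

/-- The terms for the scalars, the coordinates and the Gram data with respect to the vector
variables selected by `s`. -/
def gramTerm {r : ℕ} (s : Fin r → Fin n) : Idx m n r → Term m n Srt.K :=
  Sum.elim kvar <| Sum.elim (fun x => coordTerm s x.1 x.2) <|
    Sum.elim (fun i => q (vvar (s i))) fun x => beta (vvar (s x.1)) (vvar (s x.2))

theorem isQF_foldr_and {l : List (Formula m n)} (h : ∀ φ ∈ l, φ.IsQF) :
    (l.foldr Formula.and bot.not).IsQF := by
  induction l with
  | nil => exact ⟨trivial, trivial⟩
  | cons φ l ih =>
    have h1 := h φ (by simp)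
    have h2 := ih fun ψ hψ => h ψ (by simp [hψ])
    exact ⟨⟨h1, h2, trivial⟩, trivial⟩

theorem isQF_basisFormula {r : ℕ} (s : Fin r → Fin n) : (basisFormula s : Formula m n).IsQF := by
  have h1 : (indepFormula s : Formula m n).IsQF := by
    cases r
    · exact ⟨trivial, trivial⟩
    · trivial
  refine ⟨⟨h1, isQF_foldr_and fun φ hφ => ?_, trivial⟩, trivial⟩
  obtain ⟨j, rfl⟩ := (List.mem_ofFn' _ _).1 hφ
  trivial

variable {M : Struc.{u}} [Field M.K] [AddCommGroup M.V] [Module M.K M.V]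
  {Q : QuadraticForm M.K M.V}

theorem IsOrth.realize_indepFormula (hM : IsOrth M Q) {r : ℕ} (s : Fin r → Fin n)
    (a : Fin m → M.K) (b : Fin n → M.V) :
    (indepFormula s).Realize M a b ↔ LinearIndependent M.K (b ∘ s) := by
  cases r with
  | zero => exact iff_of_true id linearIndependent_empty_type
  | succ r => exact hM.theta r _

theorem IsOrth.realize_basisFormula (hM : IsOrth M Q) {r : ℕ} (s : Fin r → Fin n)
    (a : Fin m → M.K) (b : Fin n → M.V) :
    (basisFormula s).Realize M a b ↔ LinearIndependent M.K (b ∘ s) ∧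
      b = combine (b ∘ s) fun j i => (coordTerm s j i).valK M a b := by
  rw [basisFormula, realize_and, hM.realize_indepFormula, realize_conj, funext_iff]
  refine and_congr_right fun _ => forall_congr' fun j => iff_of_eq ?_
  exact congrArg (b j = ·) (valV_vsum_smul M hM.vzero hM.vadd hM.smul _ _ a b)

theorem IsOrth.valK_gramTerm (hM : IsOrth M Q) {r : ℕ} (s : Fin r → Fin n)
    (a : Fin m → M.K) (b : Fin n → M.V) (l : Idx m n r) :
    (gramTerm s l).valK M a b =
      gramAssign Q (b ∘ s) a (fun j i => (coordTerm s j i).valK M a b) l := by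
  obtain i | ⟨j, i⟩ | i | ⟨i, j⟩ := l
  · rfl
  · rfl
  · exact hM.q _
  · change M.kadd (M.kadd (M.q (M.vadd (b (s i)) (b (s j)))) (M.kneg (M.q (b (s i)))))
      (M.kneg (M.q (b (s j)))) = _
    simp only [hM.kadd, hM.kneg, hM.vadd, hM.q, ← sub_eq_add_neg]
    rfl

/-- Among finitely many vectors there is a basis of their span. -/
theorem IsOrth.exists_realize_basisFormula (hM : IsOrth M Q) (a : Fin m → M.K)
    (b : Fin n → M.V) :
    ∃ (r : Fin (n + 1)) (s : Fin r → Fin n), (basisFormula s).Realize M a b := by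
  obtain ⟨κ, e, he, hspan, hli⟩ := exists_linearIndependent' M.K b
  have : Finite κ := Finite.of_injective e he
  have hcard : Nat.card κ < n + 1 :=
    Nat.lt_succ_of_le ((Nat.card_le_card_of_injective e he).trans (by simp))
  let f : Fin (Nat.card κ) ≃ κ := (Finite.equivFin κ).symm
  refine ⟨⟨Nat.card κ, hcard⟩, e ∘ f, (hM.realize_basisFormula _ a b).2 ⟨hli.comp f f.injective,
    funext fun j => ?_⟩⟩
  have hj : b j ∈ Submodule.span M.K (Set.range (b ∘ e ∘ f)) := by
    rw [show b ∘ e ∘ f = (b ∘ e) ∘ f from rfl, f.surjective.range_comp, hspan]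
    exact Submodule.subset_span ⟨j, rfl⟩
  obtain ⟨α, hα⟩ := (Submodule.mem_span_range_iff_exists_fun _).1 hj
  have hli' : LinearIndependent M.K (b ∘ e ∘ f) := hli.comp f f.injective
  clear_value f
  dsimp only
  clear hspan hcard
  generalize Nat.card κ = r at *
  refine hα.symm.trans (Finset.sum_congr rfl fun i _ => congrArg (· • _) ?_)
  cases r with
  | zero => exact i.elim0
  | succ r =>
    refine (hM.coord r i _ α hli').symm.trans ?_
    rw [hα]
    rfl

end Selection

/-- A formula is equivalent, in infinite dimensional orthogonal spaces over perfect fields with a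
property `S`, to a conjunction of implications from quantifier-free formulas to field formulas
evaluated at terms, hence to a formula in any class which is closed under implication, contains
the quantifier-free formulas and, up to equivalence, contains the field formulas evaluated at
terms. -/
theorem Formula.exists_equivalent {m n : ℕ} (φ : Formula m n) (C : Formula m n → Prop)
    (S : ∀ (K : Type u) [Field K], Prop) (hqf : ∀ ψ : Formula m n, ψ.IsQF → C ψ)
    (himp : ∀ ψ χ : Formula m n, C ψ → C χ → C (ψ.imp χ))
    (hfield : ∀ (r : ℕ) (θ : FieldFormula (Idx m n r)) (τ : Idx m n r → Term m n Srt.K),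
      ∃ ψ : Formula m n, C ψ ∧ ∀ (M : Struc.{u}) [Field M.K] [AddCommGroup M.V] [Module M.K M.V]
        (Q : QuadraticForm M.K M.V), IsOrth M Q → S M.K → ∀ (a : Fin m → M.K) (b : Fin n → M.V),
          ψ.Realize M a b ↔ θ.Realize M.K fun l => (τ l).valK M a b) :
    ∃ ψ : Formula m n, C ψ ∧ ∀ (M : Struc.{u}) [Field M.K] [AddCommGroup M.V] [Module M.K M.V]
      (Q : QuadraticForm M.K M.V), IsOrth M Q → ¬ FiniteDimensional M.K M.V →
      (∀ x : M.K, ∃ y, y * y = x) → S M.K → ∀ (a : Fin m → M.K) (b : Fin n → M.V),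
        φ.Realize M a b ↔ ψ.Realize M a b := by
  choose P hP hP' using Formula.reduces.{u} φ
  choose θ hθ using hP
  choose ψ hψ hψ' using fun r (s : Fin r → Fin n) => hfield r (θ r) (gramTerm s)
  let f := (Finite.equivFin (Σ r : Fin (n + 1), (Fin r → Fin n))).symm
  have hand : ∀ l : List (Formula m n), (∀ χ ∈ l, C χ) → C (l.foldr Formula.and bot.not) := by
    intro l hl
    induction l with
    | nil => exact hqf _ ⟨trivial, trivial⟩
    | cons χ l ih =>
      have hbot : C bot := hqf _ trivial
      exact himp _ _ (himp _ _ (hl χ (by simp)) (himp _ _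
        (ih fun ω hω => hl ω (by simp [hω])) hbot)) hbot
  refine ⟨conj fun k => (basisFormula (f k).2).imp (ψ _ (f k).2), hand _ fun χ hχ => ?_,
    fun M _ _ _ Q hM hdim hsq hS a b => ?_⟩
  · obtain ⟨k, rfl⟩ := (List.mem_ofFn' _ _).1 hχ
    exact himp _ _ (hqf _ (isQF_basisFormula _)) (hψ _ _)
  · have key : ∀ (r : ℕ) (s : Fin r → Fin n), (basisFormula s).Realize M a b →
        (φ.Realize M a b ↔ (ψ r s).Realize M a b) := by
      intro r s hs
      obtain ⟨hli, hb⟩ := (hM.realize_basisFormula s a b).1 hs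
      rw [hψ' r s M Q hM hS, hθ, funext (hM.valK_gramTerm s a b), ← hP' r M Q hM hdim hsq _ hli,
        ← hb]
    rw [realize_conj]
    constructor
    · exact fun h k hk => (key _ _ hk).1 h
    · intro h
      obtain ⟨r, s, hs⟩ := hM.exists_realize_basisFormula a b
      obtain ⟨k, hk⟩ := f.surjective ⟨r, s⟩
      have h2 := h k
      rw [hk] at h2
      exact (key _ _ hs).2 (h2 hs)

theorem valK_kpow (M : Struc.{u}) [Field M.K] (h1 : M.kone = 1)
    (hmul : ∀ x y, M.kmul x y = x * y) {m n : ℕ} (t : Term m n Srt.K) (a : Fin m → M.K)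
    (b : Fin n → M.V) (k : ℕ) : (t.kpow k).valK M a b = t.valK M a b ^ k := by
  induction k with
  | zero => exact h1.trans (pow_zero _).symm
  | succ k ih =>
    rw [pow_succ, ← ih]
    exact hmul _ _

section Models

variable {M : Struc.{u}} [Field M.K] [AddCommGroup M.V] [Module M.K M.V]
  {Q : QuadraticForm M.K M.V}

theorem IsOrth.isAlgClosed (hM : IsOrth M Q) (h : ∀ d, M.Sat (rootSentence d)) :
    IsAlgClosed M.K := by
  refine IsAlgClosed.of_exists_root _ fun p hp hirr => ?_
  obtain ⟨d, hd⟩ : ∃ d, p.natDegree = d + 1 :=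
    Nat.exists_eq_succ_of_ne_zero hirr.natDegree_pos.ne'
  obtain ⟨x, hx⟩ := (realize_exK _ _ _ _).1
    ((realize_closeK _ _ _ _).1 (h d) fun i : Fin (d + 1) => p.coeff i)
  have hlast : (kvar (Fin.last (d + 1)) : Term (d + 2) 0 Srt.K).valK M
      (Fin.snoc (α := fun _ => M.K) (fun i : Fin (d + 1) => p.coeff i) x) Fin.elim0 = x :=
    Fin.snoc_last (α := fun _ => M.K) x fun i : Fin (d + 1) => p.coeff i
  have hvar : ∀ i : Fin (d + 1), (kvar i.castSucc : Term (d + 2) 0 Srt.K).valK M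
      (Fin.snoc (α := fun _ => M.K) (fun i : Fin (d + 1) => p.coeff i) x) Fin.elim0 =
        p.coeff i := fun i =>
    Fin.snoc_castSucc (α := fun _ => M.K) x (fun i : Fin (d + 1) => p.coeff i) i
  refine ⟨x, ?_⟩
  rw [Polynomial.eval_eq_sum_range, hd, Finset.sum_range_succ, ← hd, hp.coeff_natDegree, hd,
    one_mul, add_comm, Finset.sum_range, ← hM.kzero]
  refine Eq.trans ?_ hx
  refine Eq.trans ?_ (hM.kadd _ _).symm
  refine congrArg₂ (· + ·) ?_ ?_
  · refine Eq.trans ?_ (valK_kpow M hM.kone hM.kmul _ _ _ _).symm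
    exact congrArg (· ^ (d + 1)) hlast.symm
  · refine Eq.trans ?_ (valK_ksum M hM.kzero hM.kadd _ _ _).symm
    refine Finset.sum_congr rfl fun i _ => ?_
    refine Eq.trans ?_ (hM.kmul _ _).symm
    refine congrArg₂ (· * ·) (hvar i).symm ?_
    refine Eq.trans ?_ (valK_kpow M hM.kone hM.kmul _ _ _ _).symm
    exact congrArg (· ^ (i : ℕ)) hlast.symm

theorem IsOrth.not_finiteDimensional (hM : IsOrth M Q) (h : ∀ r, M.Sat (dimSentence r)) :
    ¬ FiniteDimensional M.K M.V := by
  intro hfin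
  have h1 := h (Module.finrank M.K M.V)
  simp only [Struc.Sat, dimSentence, realize_not, realize_closeV, not_forall, not_not] at h1
  obtain ⟨v, hv⟩ := h1
  have := ((hM.theta _ v).1 hv).fintype_card_le_finrank
  simp at this

/-- Every element of the field is a square. -/
def perfectSentence : Sentence :=
  allK (exK (eqK (kvar (Fin.last 1) * kvar (Fin.last 1)) (kvar (Fin.castSucc (Fin.last 0)))))

theorem IsOrth.sat_perfectSentence_iff (hM : IsOrth M Q) :
    M.Sat perfectSentence ↔ ∀ x : M.K, ∃ y, y * y = x := by
  simp only [← hM.kmul]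
  exact forall_congr' fun x => realize_exK _ _ _ _

end Models

/-- Finite fields of characteristic two are perfect, and so are the fields of pseudo-finite
orthogonal spaces. -/
theorem Struc.IsPseudoFinite.sat_perfectSentence {M : Struc.{u}} (h : M.IsPseudoFinite) :
    M.Sat perfectSentence := by
  by_contra hM
  obtain ⟨N, hfin, hN, hsat⟩ := h.approx perfectSentence.not hM
  obtain ⟨_, _, _, Q, hNQ⟩ := exists_isOrth hN
  refine hsat (hNQ.sat_perfectSentence_iff.2 fun x => ?_)
  have : Finite N.K := Finite.of_injective (Sum.inl : N.K → N.K ⊕ N.V) Sum.inl_injective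
  have : CharP N.K 2 := CharTwo.of_one_ne_zero_of_two_eq_zero one_ne_zero
    (one_add_one_eq_two.symm.trans hNQ.two_eq_zero)
  obtain ⟨y, hy⟩ := FiniteField.isSquare_of_char_two (ringChar.eq N.K 2) x
  exact ⟨y, hy.symm⟩

end Orth

theorem mainTheorem1 (T : Orth.Theory)
    (hT : Orth.Theory.IsCompletionOf.{u} T Orth.TO)
    (hdim : Orth.Theory.AssertsInfiniteDim.{u} T)
    (hK : Orth.Theory.IsPseudoFinite.{u} T ∨ Orth.Theory.AssertsAlgClosed.{u} T) :
    Orth.Theory.EliminatesQuantifiersDownToField.{u} T ∧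
      (Orth.Theory.AssertsAlgClosed.{u} T → Orth.Theory.EliminatesQuantifiers.{u} T) := by
  have hTO : ∀ M : Orth.Struc.{u}, M.Models T → M.Models Orth.TO := fun M hM φ hφ =>
    hT.entails φ hφ M hM _ _
  have hperfect : ∀ (M : Orth.Struc.{u}) [Field M.K] [AddCommGroup M.V] [Module M.K M.V]
      (Q : QuadraticForm M.K M.V), Orth.IsOrth M Q → M.Models T →
      ∀ x : M.K, ∃ y, y * y = x := by
    intro M _ _ _ Q hQ hM
    obtain hpf | hac := hK
    · exact hQ.sat_perfectSentence_iff.1 (hpf M hM).sat_perfectSentence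
    · have := hQ.isAlgClosed fun d => hac d M hM _ _
      exact fun x => (IsAlgClosed.exists_eq_mul_self x).imp fun _ h => h.symm
  constructor
  · intro m n φ
    obtain ⟨ψ, hψ, hψ'⟩ := φ.exists_equivalent Orth.Formula.IsQFDownToField (fun _ _ => True)
      (fun _ => .of_isQF) (fun _ _ => .imp) fun r θ τ => by
        let e := Finite.equivFin (Orth.Idx m n r)
        obtain ⟨ψ, hψ, -, hψ'⟩ := θ.exists_isRing e
        refine ⟨_, .of_ring ψ (τ ∘ e.symm) hψ, fun M _ _ _ Q hM _ a b => ?_⟩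
        rw [Orth.Formula.realize_subst, hψ' M Q hM]
        simp [Function.comp_def]
    refine ⟨ψ, hψ, fun M hM a b => (Orth.realize_iff _ _ _ _ _).2 ?_⟩
    obtain ⟨_, _, _, Q, hQ⟩ := Orth.exists_isOrth (hTO M hM)
    exact hψ' M Q hQ (hQ.not_finiteDimensional fun r => hdim r M hM _ _) (hperfect M Q hQ hM)
      trivial a b
  · intro hac m n φ
    obtain ⟨ψ, hψ, hψ'⟩ := φ.exists_equivalent Orth.Formula.IsQF (fun K _ => IsAlgClosed K)
      (fun _ h => h) (fun _ _ h₁ h₂ => ⟨h₁, h₂⟩) fun r θ τ => by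
        let e := Finite.equivFin (Orth.Idx m n r)
        obtain ⟨θ', hθ', hθ⟩ := θ.exists_isQF_of_isAlgClosed
        obtain ⟨ψ, -, hψ, hψ'⟩ := θ'.exists_isRing e
        refine ⟨_, (hψ hθ').subst (τ ∘ e.symm) Fin.elim0, fun M _ _ _ Q hM hac a b => ?_⟩
        rw [Orth.Formula.realize_subst, hψ' M Q hM, hθ]
        simp [Function.comp_def]
    refine ⟨ψ, hψ, fun M hM a b => (Orth.realize_iff _ _ _ _ _).2 ?_⟩
    obtain ⟨_, _, _, Q, hQ⟩ := Orth.exists_isOrth (hTO M hM)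
    exact hψ' M Q hQ (hQ.not_finiteDimensional fun r => hdim r M hM _ _) (hperfect M Q hQ hM)
      (hQ.isAlgClosed fun d => hac d M hM _ _) a b
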